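/- Let $\{f_\theta:\theta\in\Theta\subset\mathbb R^p\}$ be probability densities with respect to a $\sigma$-finite measure $\mu$, and let $\beta\ge 0$. Write $u_\theta=\partial_\theta\log f_\theta$ and $$J(\theta)=\int u_\theta u_\theta^T f_\theta^{1+\beta}\,d\mu,\qquad K(\theta)=\int u_\theta u_\theta^T f_\theta^{1+2\beta}\,d\mu-\xi(\theta)\xi(\theta)^T,\qquad \xi(\theta)=\int u_\theta f_\theta^{1+\beta}\,d\mu .$$ Let $V_\theta(x)=\int f_\theta^{1+\beta}\,d\mu-(1+\tfrac1\beta)f_\theta^{\beta}(x)$ for $\beta>0$ and $V_\theta(x)=-\log f_\theta(x)$ for $\beta=0$. Let $\theta_0\in\Theta$ and let $\omega\subset\Theta$ be an open set containing $\theta_0$. Assume the standard regularity conditions with true density $f_{\theta_0}$: * (D1) the set $\{x: f_\theta(x)>0\}$ does not depend on $\theta\in\Theta$; * (D2) for $\mu$-almost every $x$, $\theta\mapsto f_\theta(x)$ is three times continuously differentiable on $\omega$; * (D3) on $\omega$, the integrals $\int f_\theta^{1+\beta}\,d\mu$ and $\int f_\theta^{\beta}f_{\theta_0}\,d\mu$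 can be differentiated three times with respect to $\theta$, under the integral sign; * (D4) $J(\theta_0)$ is positive definite; * (D5) for all $j,k,l$ there is a function $B_{jkl}$ with $\int |B_{jkl}|f_{\theta_0}\,d\mu<\infty$ and $|\partial_j\partial_k\partial_l V_\theta(x)|\le B_{jkl}(x)$ for all $\theta\in\omega$ and almost every $x$ in the support. Assume also that $J$ and $K$ are continuous at $\theta_0$ and that $K(\theta_0)$ is positive definite. Let $m$ be an $\mathbb R^r$-valued function on $\mathbb R^p$ that is continuously differentiable on the interior of $\Theta$, and let $M(\theta)=\partial m^T(\theta)/\partial\theta$ be its $p\times r$ derivative matrix. Assume $m(\theta_0)=0$ and $\operatorname{rank}M(\theta_0)=r$. Put $\Sigma(\theta)=M^T(\theta)J^{-1}(\theta)K(\theta)J^{-1}(\theta)M(\theta)$. Let $\widehat\theta_n=\widehat\theta_n(X_1,\dots,X_n)$ be a sequence of measurable statistics which, for i.i.d. data from $f_{\theta_0}$, is consistent for $\theta_0$ and with probability tending to one solves the minimum density power divergence estimating equation $$\frac1n\sum_{i=1}^n u_\theta(X_i)f_\theta^\beta(X_i)-\int u_\theta f_\theta^{1+\beta}\,d\mu=0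 .$$ Let $W_n=n\,m^T(\widehat\theta_n)\,\Sigma(\widehat\theta_n)^{-1}\,m(\widehat\theta_n)$. For each $n$ let $X_1,\dots,X_n$ be i.i.d. with density $f_{\theta_n}$, where $\theta_n$ is a sequence of contiguous alternatives, i.e. the joint laws of $(X_1,\dots,X_n)$ under $\theta_n$ are contiguous (in Le Cam's sense) with respect to those under $\theta_0$. (i) If $\theta_n=\theta_0+n^{-1/2}d$ with $d\in\mathbb R^p$, then $W_n$ converges in law to the noncentral chi-square distribution with $r$ degrees of freedom and noncentrality parameter $d^TM(\theta_0)\,\Sigma(\theta_0)^{-1}M^T(\theta_0)\,d$. (ii) If $\theta_n\to\theta_0$ and $m(\theta_n)=n^{-1/2}\delta$ for all large $n$, with $\delta\in\mathbb R^r$, then $W_n$ converges in law to the noncentral chi-square distribution with $r$ degrees of freedom and noncentrality parameter $\delta^T\,\Sigma(\theta_0)^{-1}\delta$. -/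

import Mathlib

open MeasureTheory ProbabilityTheory Filter Topology Matrix

noncomputable section

namespace DPD

/-! ### Parametric model, score, and the matrices `J` and `K` -/

/-- The partial derivative `∂φ/∂θ_j` at `θ`. -/
def pd {p : ℕ} (j : Fin p) (φ : (Fin p → ℝ) → ℝ) (θ : Fin p → ℝ) : ℝ :=
  fderiv ℝ φ θ (Pi.single j 1)

variable {p r : ℕ} {X : Type*} [MeasurableSpace X]

/-- `{f θ : θ ∈ Θ}` is a family of probability densities with respect to `μ`. -/
structure IsDensityFamily (μ : Measure X) (Θ : Set (Fin p → ℝ)) (f : (Fin p → ℝ) → X → ℝ) :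
    Prop where
  measurable : ∀ θ ∈ Θ, Measurable (f θ)
  nonneg : ∀ θ ∈ Θ, ∀ x, 0 ≤ f θ x
  lintegral_eq_one : ∀ θ ∈ Θ, ∫⁻ x, ENNReal.ofReal (f θ x) ∂μ = 1

/-- The joint law of a random sample `X_1, …, X_n` from the density `f θ`. -/
def sampleLaw (μ : Measure X) (f : (Fin p → ℝ) → X → ℝ) (θ : Fin p → ℝ) (n : ℕ) :
    Measure (Fin n → X) :=
  Measure.pi fun _ => μ.withDensity fun x => ENNReal.ofReal (f θ x)

/-- The score function `u_θ(x) = ∂/∂θ log f_θ(x)`. -/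
def score (f : (Fin p → ℝ) → X → ℝ) (θ : Fin p → ℝ) (x : X) : Fin p → ℝ :=
  fun j => pd j (fun θ' => Real.log (f θ' x)) θ

/-- The Fisher information function `I_θ(x) = -∂u_θ(x)/∂θᵀ`. -/
def infoFun (f : (Fin p → ℝ) → X → ℝ) (θ : Fin p → ℝ) (x : X) : Matrix (Fin p) (Fin p) ℝ :=
  Matrix.of fun j k => -pd k (fun θ' => score f θ' x j) θ

/-- `ξ_β(θ) = ∫ u_θ f_θ^β g`. -/
def xiVec (μ : Measure X) (f : (Fin p → ℝ) → X → ℝ) (β : ℝ) (g : X → ℝ) (θ : Fin p → ℝ) :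
    Fin p → ℝ :=
  fun j => ∫ x, score f θ x j * f θ x ^ β * g x ∂μ

/-- `J_β(θ)` when the true density is `g`. -/
def JMat (μ : Measure X) (f : (Fin p → ℝ) → X → ℝ) (β : ℝ) (g : X → ℝ) (θ : Fin p → ℝ) :
    Matrix (Fin p) (Fin p) ℝ :=
  Matrix.of fun j k =>
    (∫ x, score f θ x j * score f θ x k * f θ x ^ (1 + β) ∂μ) +
    ∫ x, (infoFun f θ x j k - β * (score f θ x j * score f θ x k)) *
      (g x - f θ x) * f θ x ^ β ∂μ

/-- `K_β(θ)` when the true density is `g`. -/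
def KMat (μ : Measure X) (f : (Fin p → ℝ) → X → ℝ) (β : ℝ) (g : X → ℝ) (θ : Fin p → ℝ) :
    Matrix (Fin p) (Fin p) ℝ :=
  Matrix.of fun j k =>
    (∫ x, score f θ x j * score f θ x k * f θ x ^ (2 * β) * g x ∂μ) -
      xiVec μ f β g θ j * xiVec μ f β g θ k

/-- `J_β(θ)` at the model, that is, with true density `f_θ`. -/
def J (μ : Measure X) (f : (Fin p → ℝ) → X → ℝ) (β : ℝ) (θ : Fin p → ℝ) :
    Matrix (Fin p) (Fin p) ℝ :=
  JMat μ f β (f θ) θ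

/-- `K_β(θ)` at the model, that is, with true density `f_θ`. -/
def K (μ : Measure X) (f : (Fin p → ℝ) → X → ℝ) (β : ℝ) (θ : Fin p → ℝ) :
    Matrix (Fin p) (Fin p) ℝ :=
  KMat μ f β (f θ) θ

/-- The function `V_θ(x)` whose sample mean the minimum density power divergence estimator
minimizes; for `β = 0` it is the negative log-likelihood. -/
def V (μ : Measure X) (f : (Fin p → ℝ) → X → ℝ) (β : ℝ) (θ : Fin p → ℝ) (x : X) : ℝ :=
  if β = 0 then -Real.log (f θ x)
  else (∫ y, f θ y ^ (1 + β) ∂μ) - (1 + 1 / β) * f θ x ^ β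

/-! ### Regularity conditions -/

/-- On `ω`, the integral `∫ F_θ dμ` can be differentiated `k` times with respect to `θ`, and
the derivatives can be taken under the integral sign. -/
def DiffUnderIntegral (μ : Measure X) (ω : Set (Fin p → ℝ)) :
    ℕ → ((Fin p → ℝ) → X → ℝ) → Prop
  | 0, F => ∀ θ ∈ ω, Integrable (F θ) μ
  | k + 1, F =>
    (∀ θ ∈ ω, Integrable (F θ) μ ∧ DifferentiableAt ℝ (fun θ' => ∫ x, F θ' x ∂μ) θ ∧
      ∀ j, pd j (fun θ' => ∫ x, F θ' x ∂μ) θ = ∫ x, pd j (fun θ' => F θ' x) θ ∂μ) ∧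
    ∀ j, DiffUnderIntegral μ ω k (fun θ x => pd j (fun θ' => F θ' x) θ)

/-- The standard regularity conditions for minimum density power divergence estimation with
true density `g` and best fitting parameter `θ₀`, on the neighbourhood `ω` of `θ₀`. -/
structure Regularity (μ : Measure X) (Θ : Set (Fin p → ℝ)) (f : (Fin p → ℝ) → X → ℝ) (β : ℝ)
    (g : X → ℝ) (θ₀ : Fin p → ℝ) (ω : Set (Fin p → ℝ)) : Prop where
  /-- The set `{x | f_θ(x) > 0}` does not depend on `θ`, and it is also the support of `g`. -/
  support : ∀ θ ∈ Θ, ∀ x, 0 < f θ x ↔ 0 < g x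
  isOpen : IsOpen ω
  subset : ω ⊆ Θ
  mem : θ₀ ∈ ω
  /-- The density is three times continuously differentiable in `θ`. -/
  smooth : ∀ᵐ x ∂μ, ContDiffOn ℝ 3 (fun θ => f θ x) ω
  diff_model : DiffUnderIntegral μ ω 3 (fun θ x => f θ x ^ (1 + β))
  diff_cross : DiffUnderIntegral μ ω 3 (fun θ x => f θ x ^ β * g x)
  posDef : (JMat μ f β g θ₀).PosDef
  /-- The third partial derivatives of `V` have integrable envelopes. -/
  third : ∀ j k l : Fin p, ∃ B : X → ℝ, Integrable (fun x => B x * g x) μ ∧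
    ∀ᵐ x ∂μ, 0 < g x → ∀ θ ∈ ω,
      |pd l (fun θ₁ => pd k (fun θ₂ => pd j (fun θ₃ => V μ f β θ₃ x) θ₂) θ₁) θ| ≤ B x

/-! ### Estimator and test statistic -/

/-- `θ` solves the estimating equation of the minimum density power divergence estimator for
the sample `x`:
`n⁻¹ ∑ u_θ(x_i) f_θ(x_i)^β - ∫ u_θ f_θ^{1+β} = 0`. -/
def IsRoot (μ : Measure X) (f : (Fin p → ℝ) → X → ℝ) (β : ℝ) {n : ℕ} (x : Fin n → X)
    (θ : Fin p → ℝ) : Prop :=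
  ∀ j, (n : ℝ)⁻¹ * ∑ i, score f θ (x i) j * f θ (x i) ^ β -
    ∫ y, score f θ y j * f θ y ^ (1 + β) ∂μ = 0

/-- A sequence of statistics which, when the true parameter is `θ₀`, is a consistent sequence
of roots of the estimating equation (roots with probability tending to one). -/
structure IsConsistentRootSeq (μ : Measure X) (f : (Fin p → ℝ) → X → ℝ) (β : ℝ)
    (θ₀ : Fin p → ℝ) (T : ∀ n : ℕ, (Fin n → X) → Fin p → ℝ) : Prop where
  measurable : ∀ n, Measurable (T n)
  root : Tendsto (fun n => sampleLaw μ f θ₀ n {x | ¬ IsRoot μ f β x (T n x)}) atTop (𝓝 0)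
  consistent : ∀ ε > 0,
    Tendsto (fun n => sampleLaw μ f θ₀ n {x | ε ≤ dist (T n x) θ₀}) atTop (𝓝 0)

/-- The `p × r` matrix `M(θ) = ∂mᵀ(θ)/∂θ`. -/
def MMat (m : (Fin p → ℝ) → Fin r → ℝ) (θ : Fin p → ℝ) : Matrix (Fin p) (Fin r) ℝ :=
  Matrix.of fun i k => pd i (fun θ' => m θ' k) θ

/-- `Mᵀ(θ) J⁻¹(θ) K(θ) J⁻¹(θ) M(θ)`. -/
def sigmaMat (μ : Measure X) (f : (Fin p → ℝ) → X → ℝ) (β : ℝ)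
    (m : (Fin p → ℝ) → Fin r → ℝ) (θ : Fin p → ℝ) : Matrix (Fin r) (Fin r) ℝ :=
  (MMat m θ)ᵀ * (J μ f β θ)⁻¹ * K μ f β θ * (J μ f β θ)⁻¹ * MMat m θ

/-- The Wald-type statistic for sample size `n`, as a function of the estimate `θ`. -/
def wald (μ : Measure X) (f : (Fin p → ℝ) → X → ℝ) (β : ℝ)
    (m : (Fin p → ℝ) → Fin r → ℝ) (n : ℕ) (θ : Fin p → ℝ) : ℝ :=
  n * (m θ ⬝ᵥ (sigmaMat μ f β m θ)⁻¹ *ᵥ m θ)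

/-! ### Contiguity, convergence in law, noncentral chi-square -/

/-- The sequence `Q` is contiguous with respect to the sequence `P` (Le Cam). -/
def Contiguous {Ω : ℕ → Type*} [∀ n, MeasurableSpace (Ω n)] (Q P : ∀ n, Measure (Ω n)) : Prop :=
  ∀ A : ∀ n, Set (Ω n), (∀ n, MeasurableSet (A n)) →
    Tendsto (fun n => P n (A n)) atTop (𝓝 0) → Tendsto (fun n => Q n (A n)) atTop (𝓝 0)

/-- Under `P n`, the real random variables `Y n` converge in law to `ν`: the distribution
functions converge at every continuity point of the limiting distribution function. -/
def ConvergesInLaw {Ω : ℕ → Type*} [∀ n, MeasurableSpace (Ω n)] (P : ∀ n, Measure (Ω n))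
    (Y : ∀ n, Ω n → ℝ) (ν : Measure ℝ) : Prop :=
  ∀ t : ℝ, ν {t} = 0 →
    Tendsto (fun n => (P n).real {x | Y n x ≤ t}) atTop (𝓝 (ν.real (Set.Iic t)))

/-- The noncentral chi-square law with `r` degrees of freedom and noncentrality `c ≥ 0`: the
law of `∑ (Z_i + a_i)²` with `Z_i` independent standard normal and `∑ a_i² = c`. By rotation
invariance it does not depend on the choice of `a`; all `a_i` are taken equal here. -/
def noncentralChiSq (r : ℕ) (c : ℝ) : Measure ℝ :=
  (Measure.pi fun _ : Fin r => gaussianReal 0 1).map fun z => ∑ i, (z i + √(c / r)) ^ 2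

end DPD

end

open DPD

/-!
The argument needs no likelihood expansion: contiguity and a central limit theorem for triangular
arrays suffice. Write `Ψ_n(θ)` for the left-hand side of the estimating equation, and call
`estFun` its summand, which is `-(1 + β)⁻¹ ∂V/∂θ` (`Regularity.pd_V`).

*Reduction.* In both parts `θ_n → θ₀` and `n^{1/2} m(θ_n) → η`, with `η = M(θ₀)ᵀ d` in the first
part and `η = δ` in the second. Only this is used about `θ_n`, besides contiguity
(`convergesInLaw_wald_of_tendsto`).

*Linearization.* Convergence in probability is expressed as convergence along the filter `whp P`
of events whose probability tends to one. Contiguity is the inequality `whp Q ≤ whp P`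
(`Contiguous.whp_le`), so consistency, the estimating equation, and the laws of large numbers for
the Hessian of `V` and for the envelope of the third derivatives carry over from `θ₀` to `θ_n`. The
expectation of the Hessian of `V` is `(1 + β) J(θ₀)` (`Regularity.integral_pd_pd_V`), and Taylor
expansion around `θ_n` gives `n^{1/2} Ψ_n(θ_n) = (J(θ₀) + o_P(1)) n^{1/2} (T_n - θ_n)`
(`exists_linearization`).

*Central limit theorem.* Under `θ_n` the summands of `Ψ_n(θ_n)` are centred with covariance
`K(θ_n)`. They converge almost everywhere, together with the densities, and `K(θ_n) → K(θ₀)`;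
dominated convergence with varying dominating functions then replaces Lindeberg's condition
(`tendsto_charFun_pow`). By Lévy's theorem `n^{1/2} Ψ_n(θ_n)` converges weakly to `N(0, K(θ₀))`,
and it is tight.

*Conclusion.* The delta method (`tendsto_deltaMethod`) gives
`n^{1/2} m(T_n) = η + Mᵀ J⁻¹ n^{1/2} Ψ_n(θ_n) + o_P(1)`, and Slutsky's theorem
(`BoundedInProb.slutsky`) permits replacing `Σ(T_n)⁻¹` by `Σ(θ₀)⁻¹`. The limit law of the
statistic is that of `‖v + Z‖²` with `Z` standard normal and `‖v‖² = ηᵀ Σ(θ₀)⁻¹ η`, which by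
rotation invariance is noncentral chi-square (`map_multivariateGaussian_wald`).
-/

noncomputable section

namespace DPD

/-! ### Convergence in probability along varying probability spaces -/

section Asymptotics

variable {Ω : ℕ → Type*} [∀ n, MeasurableSpace (Ω n)]

/-- The filter of events whose probability under `P n` tends to one. An event is a set of pairs
`⟨n, x⟩` with `x : Ω n`, and `P n` is applied to possibly non-measurable sets, as an outer measure.
Convergence in probability is convergence along this filter. -/
def whp (P : ∀ n, Measure (Ω n)) : Filter (Σ n, Ω n) where
  sets := {s | Tendsto (fun n => P n {x | (⟨n, x⟩ : Σ n, Ω n) ∉ s}) atTop (𝓝 0)}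
  univ_sets := by simp
  sets_of_superset := by
    intro s t hs hst
    refine tendsto_of_tendsto_of_tendsto_of_le_of_le tendsto_const_nhds hs (fun _ => zero_le)
      fun n => measure_mono fun x hx hxs => hx (hst hxs)
  inter_sets := by
    intro s t hs ht
    have h := Tendsto.add hs ht
    rw [add_zero] at h
    refine tendsto_of_tendsto_of_tendsto_of_le_of_le tendsto_const_nhds h (fun _ => zero_le)
      fun n => (measure_mono ?_).trans (measure_union_le _ _)
    intro x hx
    by_cases hxs : (⟨n, x⟩ : Σ n, Ω n) ∈ s
    · exact Or.inr fun hxt => hx ⟨hxs, hxt⟩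
    · exact Or.inl hxs

lemma mem_whp {P : ∀ n, Measure (Ω n)} {s : Set (Σ n, Ω n)} :
    s ∈ whp P ↔ Tendsto (fun n => P n {x | (⟨n, x⟩ : Σ n, Ω n) ∉ s}) atTop (𝓝 0) := Iff.rfl

lemma eventually_whp {P : ∀ n, Measure (Ω n)} {p : (Σ n, Ω n) → Prop} :
    (∀ᶠ ω in whp P, p ω) ↔ Tendsto (fun n => P n {x | ¬ p ⟨n, x⟩}) atTop (𝓝 0) := Iff.rfl

lemma tendsto_fst_whp (P : ∀ n, Measure (Ω n)) : Tendsto Sigma.fst (whp P) atTop := by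
  intro s hs
  refine mem_whp.2 (tendsto_const_nhds.congr' ?_)
  filter_upwards [hs] with n hn
  have : {x : Ω n | (⟨n, x⟩ : Σ n, Ω n) ∉ Sigma.fst ⁻¹' s} = ∅ := by
    ext x; simpa using hn
  rw [this, measure_empty]

lemma eventually_whp_of_ae {P : ∀ n, Measure (Ω n)} {p : (Σ n, Ω n) → Prop}
    (h : ∀ n, ∀ᵐ x ∂P n, p ⟨n, x⟩) : ∀ᶠ ω in whp P, p ω := by
  refine eventually_whp.2 (tendsto_const_nhds.congr fun n => ?_)
  exact (ae_iff.1 (h n)).symm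

/-- Contiguity says that events of `P`-probability tending to one also have `Q`-probability
tending to one. -/
lemma Contiguous.whp_le {Q P : ∀ n, Measure (Ω n)} (h : Contiguous Q P) : whp Q ≤ whp P := by
  intro s hs
  have h1 := h (fun n => toMeasurable (P n) {x | (⟨n, x⟩ : Σ n, Ω n) ∉ s})
    (fun n => measurableSet_toMeasurable _ _)
    (by simpa only [measure_toMeasurable] using mem_whp.1 hs)
  exact tendsto_of_tendsto_of_tendsto_of_le_of_le tendsto_const_nhds h1 (fun _ => zero_le)
    fun n => measure_mono (subset_toMeasurable _ _)

/-- Tightness (boundedness in probability) of the random elements `Y`. -/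
def BoundedInProb {E : Type*} [TopologicalSpace E] (P : ∀ n, Measure (Ω n))
    (Y : (Σ n, Ω n) → E) : Prop :=
  ∀ ε > 0, ∃ C : Set E, IsCompact C ∧ ∀ n, P n {x | Y ⟨n, x⟩ ∉ C} ≤ ε

/-- Slutsky's theorem: a parameter converging in probability may be replaced by its limit
inside a continuous function of it and of a tight sequence. -/
lemma BoundedInProb.slutsky {E F : Type*} [TopologicalSpace E] [TopologicalSpace F]
    {P : ∀ n, Measure (Ω n)} {Y : (Σ n, Ω n) → E} (hY : BoundedInProb P Y)
    {g : E → F → ℝ} (hg : Continuous (Function.uncurry g)) {Z : (Σ n, Ω n) → F} {c : F}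
    (hZ : Tendsto Z (whp P) (𝓝 c)) :
    Tendsto (fun ω => g (Y ω) (Z ω) - g (Y ω) c) (whp P) (𝓝 0) := by
  rw [Metric.tendsto_nhds]
  intro ε hε
  rw [eventually_whp, ENNReal.tendsto_nhds_zero]
  intro δ hδ
  obtain ⟨C, hC, hCP⟩ := hY (δ / 2) (ENNReal.half_pos hδ.ne')
  have hU : ∀ᶠ z in 𝓝 c, ∀ s ∈ C, dist (g s z - g s c) 0 < ε := by
    refine hC.eventually_forall_of_forall_eventually fun s _ => ?_
    have hcont : Continuous fun q : F × E => g q.2 q.1 - g q.2 c :=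
      (hg.comp (by fun_prop : Continuous fun q : F × E => (q.2, q.1))).sub
        (hg.comp (by fun_prop : Continuous fun q : F × E => (q.2, c)))
    have := hcont.tendsto (c, s)
    rw [sub_self] at this
    exact (Metric.tendsto_nhds.1 this) ε hε
  have h2 := ENNReal.tendsto_nhds_zero.1 (eventually_whp.1 (hZ.eventually hU)) (δ / 2)
    (ENNReal.half_pos hδ.ne')
  filter_upwards [h2] with n hn
  calc _ ≤ P n ({x | Y ⟨n, x⟩ ∉ C} ∪
        {x | ¬ ∀ s ∈ C, dist (g s (Z ⟨n, x⟩) - g s c) 0 < ε}) := by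
        refine measure_mono fun x hx => ?_
        by_cases hxC : Y ⟨n, x⟩ ∈ C
        · exact Or.inr fun h => hx (h _ hxC)
        · exact Or.inl hxC
    _ ≤ δ / 2 + δ / 2 := (measure_union_le _ _).trans (add_le_add (hCP n) hn)
    _ = δ := ENNReal.add_halves δ

/-- If `Y` converges weakly to `ν`, then a random variable `W` at vanishing distance (in
probability) from `g (Y)` converges in law to the image of `ν` under the continuous function `g`.
No measurability of `W` is needed. -/
lemma convergesInLaw_of_tendsto_sub {E : Type*} [TopologicalSpace E] [MeasurableSpace E]
    [BorelSpace E] [HasOuterApproxClosed E] {P : ∀ n, Measure (Ω n)} [∀ n, IsProbabilityMeasure (P n)]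
    {Y : (Σ n, Ω n) → E} (hY : ∀ n, AEMeasurable (fun x => Y ⟨n, x⟩) (P n))
    {ν : ProbabilityMeasure E}
    (h : Tendsto (β := ProbabilityMeasure E) (fun n => ⟨(P n).map (fun x => Y ⟨n, x⟩),
      Measure.isProbabilityMeasure_map (hY n)⟩) atTop (𝓝 ν))
    {g : E → ℝ} (hg : Continuous g) {W : ∀ n, Ω n → ℝ}
    (hW : Tendsto (fun ω : Σ n, Ω n => W ω.1 ω.2 - g (Y ω)) (whp P) (𝓝 0)) :
    ConvergesInLaw P W ((ν : Measure E).map g) := by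
  intro t ht
  set ρ : Measure ℝ := (ν : Measure E).map g with hρ
  have : IsProbabilityMeasure ρ := Measure.isProbabilityMeasure_map hg.measurable.aemeasurable
  have hd : ∀ ε > 0, Tendsto (fun n => P n {x | ¬ dist (W n x - g (Y ⟨n, x⟩)) 0 < ε}) atTop
      (𝓝 0) := fun ε hε => eventually_whp.1 (Metric.tendsto_nhds.1 hW ε hε)
  have hmap : ∀ (n : ℕ) (s : Set ℝ), MeasurableSet s →
      P n {x | g (Y ⟨n, x⟩) ∈ s} = (P n).map (fun x => Y ⟨n, x⟩) (g ⁻¹' s) := by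
    intro n s hs
    rw [Measure.map_apply_of_aemeasurable (hY n) (hg.measurable hs)]
    rfl
  have hρs : ∀ s : Set ℝ, MeasurableSet s → ρ s = (ν : Measure E) (g ⁻¹' s) := fun s hs =>
    Measure.map_apply hg.measurable hs
  have key : Tendsto (fun n => P n {x | W n x ≤ t}) atTop (𝓝 (ρ (Set.Iic t))) := by
    -- Lower bound through the open sets `Iio (t - ε)`, upper bound through the closed sets
    -- `Iic (t + ε)`; the two limits agree because `{t}` is a null set.
    refine tendsto_order.2 ⟨fun a ha => ?_, fun a ha => ?_⟩
    · have hIio : ρ (Set.Iio t) = ρ (Set.Iic t) := by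
        rw [← Set.Iio_union_right, measure_union (by simp) (measurableSet_singleton t), ht,
          add_zero]
      have h1 : Tendsto (fun k : ℕ => ρ (Set.Iio (t - 1 / (k + 1)))) atTop
          (𝓝 (ρ (Set.Iio t))) := by
        have : Set.Iio t = ⋃ k : ℕ, Set.Iio (t - 1 / (k + 1)) := by
          ext x
          simp only [Set.mem_Iio, Set.mem_iUnion]
          constructor
          · intro hx
            obtain ⟨k, hk⟩ := exists_nat_one_div_lt (sub_pos.2 hx)
            exact ⟨k, by linarith⟩
          · rintro ⟨k, hk⟩
            have : (0 : ℝ) < 1 / (k + 1) := by positivity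
            linarith
        rw [this]
        refine tendsto_measure_iUnion_atTop fun i j hij => Set.Iio_subset_Iio ?_
        have : (1 : ℝ) / (j + 1) ≤ 1 / (i + 1) := by gcongr
        linarith
      obtain ⟨k, hk⟩ := ((tendsto_order.1 h1).1 a (hIio ▸ ha)).exists
      set ε : ℝ := 1 / (k + 1) with hε
      have hεpos : 0 < ε := by positivity
      obtain ⟨b, hab, hb⟩ := exists_between hk
      rw [hρs _ measurableSet_Iio] at hb
      have hopen := ProbabilityMeasure.le_liminf_measure_open_of_tendsto h
        (isOpen_Iio.preimage hg : IsOpen (g ⁻¹' Set.Iio (t - ε)))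
      have h2 := eventually_lt_of_lt_liminf (hb.trans_le hopen)
      have h3 := (tendsto_order.1 (hd ε hεpos)).2 (b - a) (tsub_pos_of_lt hab)
      filter_upwards [h2, h3] with n hn2 hn3
      have hle : P n {x | g (Y ⟨n, x⟩) ∈ Set.Iio (t - ε)} ≤
          P n {x | W n x ≤ t} + P n {x | ¬ dist (W n x - g (Y ⟨n, x⟩)) 0 < ε} := by
        refine (measure_mono fun x hx => ?_).trans (measure_union_le _ _)
        by_cases hxd : dist (W n x - g (Y ⟨n, x⟩)) 0 < ε
        · refine Or.inl ?_
          rw [Real.dist_eq, sub_zero, abs_lt] at hxd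
          simp only [Set.mem_ofPred_eq, Set.mem_Iio] at hx ⊢
          linarith
        · exact Or.inr hxd
      rw [hmap n _ measurableSet_Iio] at hle
      by_contra hcon
      push Not at hcon
      have : b < a + (b - a) := (hn2.trans_le hle).trans_le (add_le_add hcon hn3.le)
      rw [add_tsub_cancel_of_le hab.le] at this
      exact lt_irrefl _ this
    · have h1 : Tendsto (fun k : ℕ => ρ (Set.Iic (t + 1 / (k + 1)))) atTop
          (𝓝 (ρ (Set.Iic t))) := by
        have : Set.Iic t = ⋂ k : ℕ, Set.Iic (t + 1 / (k + 1)) := by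
          ext x
          simp only [Set.mem_Iic, Set.mem_iInter]
          constructor
          · intro hx k
            have : (0 : ℝ) < 1 / (k + 1) := by positivity
            linarith
          · intro hx
            by_contra hcon
            push Not at hcon
            obtain ⟨k, hk⟩ := exists_nat_one_div_lt (sub_pos.2 hcon)
            linarith [hx k]
        rw [this]
        refine tendsto_measure_iInter_atTop (fun _ => measurableSet_Iic.nullMeasurableSet)
          (fun i j hij => Set.Iic_subset_Iic.2 ?_) ⟨0, measure_ne_top _ _⟩
        have : (1 : ℝ) / (j + 1) ≤ 1 / (i + 1) := by gcongr
        linarith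
      obtain ⟨k, hk⟩ := ((tendsto_order.1 h1).2 a ha).exists
      set ε : ℝ := 1 / (k + 1) with hε
      have hεpos : 0 < ε := by positivity
      obtain ⟨b, hb, hab⟩ := exists_between hk
      rw [hρs _ measurableSet_Iic] at hb
      have hclosed := ProbabilityMeasure.limsup_measure_closed_le_of_tendsto h
        (isClosed_Iic.preimage hg : IsClosed (g ⁻¹' Set.Iic (t + ε)))
      have h2 := eventually_lt_of_limsup_lt (hclosed.trans_lt hb)
      have h3 := (tendsto_order.1 (hd ε hεpos)).2 (a - b) (tsub_pos_of_lt hab)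
      filter_upwards [h2, h3] with n hn2 hn3
      have hle : P n {x | W n x ≤ t} ≤ P n {x | g (Y ⟨n, x⟩) ∈ Set.Iic (t + ε)} +
          P n {x | ¬ dist (W n x - g (Y ⟨n, x⟩)) 0 < ε} := by
        refine (measure_mono fun x hx => ?_).trans (measure_union_le _ _)
        by_cases hxd : dist (W n x - g (Y ⟨n, x⟩)) 0 < ε
        · refine Or.inl ?_
          rw [Real.dist_eq, sub_zero, abs_lt] at hxd
          simp only [Set.mem_ofPred_eq, Set.mem_Iic] at hx ⊢
          linarith
        · exact Or.inr hxd
      rw [hmap n _ measurableSet_Iic] at hle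
      calc _ ≤ _ := hle
        _ < b + (a - b) := ENNReal.add_lt_add hn2 hn3
        _ = a := add_tsub_cancel_of_le hab.le
  exact (ENNReal.tendsto_toReal (measure_ne_top _ _)).comp key

end Asymptotics

/-! ### Limit theorems for row-wise i.i.d. samples -/

section LimitTheorems

variable {X : Type*} [MeasurableSpace X]

/-- Dominated convergence with dominating functions that vary with `n`, provided that their
integrals converge to the integral of their limit. -/
lemma tendsto_integral_of_dominated_tendsto {μ : Measure X} {F : ℕ → X → ℂ} {f : X → ℂ}
    {G : ℕ → X → ℝ} {g : X → ℝ} (hF : ∀ n, AEStronglyMeasurable (F n) μ)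
    (hG : ∀ n, Integrable (G n) μ) (hg : Integrable g μ)
    (hle : ∀ n, ∀ᵐ x ∂μ, ‖F n x‖ ≤ G n x)
    (hFf : ∀ᵐ x ∂μ, Tendsto (fun n => F n x) atTop (𝓝 (f x)))
    (hGg : ∀ᵐ x ∂μ, Tendsto (fun n => G n x) atTop (𝓝 (g x)))
    (hint : Tendsto (fun n => ∫ x, G n x ∂μ) atTop (𝓝 (∫ x, g x ∂μ))) :
    Tendsto (fun n => ∫ x, F n x ∂μ) atTop (𝓝 (∫ x, f x ∂μ)) := by
  have hfm : AEStronglyMeasurable f μ := aestronglyMeasurable_of_tendsto_ae atTop hF hFf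
  have hle' : ∀ᵐ x ∂μ, ∀ n, ‖F n x‖ ≤ G n x := ae_all_iff.2 hle
  have hfg : ∀ᵐ x ∂μ, ‖f x‖ ≤ g x := by
    filter_upwards [hle', hFf, hGg] with x h1 h2 h3
    exact le_of_tendsto_of_tendsto' h2.norm h3 h1
  have hFi : ∀ n, Integrable (F n) μ := fun n => (hG n).mono' (hF n) (hle n)
  have hfi : Integrable f μ := hg.mono' hfm hfg
  -- `‖F n - f‖ ≤ min ‖F n - f‖ (2 g) + (G n - min (G n) g)`, and both terms have integrals
  -- tending to zero by dominated convergence.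
  have h1 : Tendsto (fun n => ∫ x, min ‖F n x - f x‖ (2 * g x) ∂μ) atTop (𝓝 0) := by
    have := tendsto_integral_of_dominated_convergence (μ := μ) (f := fun _ => (0 : ℝ))
      (F := fun n x => min ‖F n x - f x‖ (2 * g x)) (fun x => 2 * g x)
      (fun n => (((hFi n).sub hfi).norm.inf (hg.const_mul 2)).aestronglyMeasurable)
      (hg.const_mul 2) (fun n => ?_) ?_
    · simpa using this
    · filter_upwards [hfg] with x hx
      have : 0 ≤ g x := (norm_nonneg _).trans hx
      rw [Real.norm_of_nonneg (le_min (norm_nonneg _) (by positivity))]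
      exact min_le_right _ _
    · filter_upwards [hFf, hfg] with x hx hx'
      have hg0 : 0 ≤ g x := (norm_nonneg _).trans hx'
      have h0 : Tendsto (fun n => ‖F n x - f x‖) atTop (𝓝 0) := by
        simpa using (hx.sub_const (f x)).norm
      have := h0.min (tendsto_const_nhds (x := 2 * g x))
      rwa [min_eq_left (by positivity)] at this
  have h2 : Tendsto (fun n => ∫ x, min (G n x) (g x) ∂μ) atTop (𝓝 (∫ x, g x ∂μ)) := by
    refine tendsto_integral_of_dominated_convergence g
      (fun n => ((hG n).inf hg).aestronglyMeasurable) hg (fun n => ?_) ?_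
    · filter_upwards [hfg, hle n] with x hx hxn
      rw [Real.norm_of_nonneg (le_min ((norm_nonneg _).trans hxn) ((norm_nonneg _).trans hx))]
      exact min_le_right _ _
    · filter_upwards [hGg] with x hx
      simpa using hx.min (tendsto_const_nhds (x := g x))
  have h3 := h1.add (hint.sub h2)
  rw [sub_self, add_zero] at h3
  rw [tendsto_iff_norm_sub_tendsto_zero]
  refine squeeze_zero (fun _ => norm_nonneg _) (fun n => ?_) h3
  rw [← integral_sub (hFi n) hfi]
  have hi1 : Integrable (fun x => min ‖F n x - f x‖ (2 * g x)) μ :=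
    ((hFi n).sub hfi).norm.inf (hg.const_mul 2)
  have hi2 : Integrable (fun x => min (G n x) (g x)) μ := (hG n).inf hg
  have hi3 : Integrable (fun x => G n x - min (G n x) (g x)) μ := (hG n).sub hi2
  refine (norm_integral_le_integral_norm _).trans ?_
  rw [← integral_sub (hG n) hi2, ← integral_add hi1 hi3]
  refine integral_mono_ae ((hFi n).sub hfi).norm (hi1.add hi3) ?_
  filter_upwards [hle n, hfg] with x hxn hx
  have htri := norm_sub_le (F n x) (f x)
  rcases le_total ‖F n x - f x‖ (2 * g x) with h | h <;>
  rcases le_total (G n x) (g x) with h' | h' <;>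
  simp [h, h'] <;> linarith

lemma norm_cexp_sub_one_sub_le (y : ℝ) :
    ‖Complex.exp (y * Complex.I) - 1 - y * Complex.I‖ ≤ 3 * y ^ 2 := by
  have hn : ‖(y : ℂ) * Complex.I‖ = |y| := by simp
  rcases le_total |y| 1 with h | h
  · refine (Complex.norm_exp_sub_one_sub_id_le (by rwa [hn])).trans ?_
    rw [hn, sq_abs]
    nlinarith [sq_nonneg y]
  · have h1 : ‖Complex.exp (y * Complex.I) - 1 - y * Complex.I‖ ≤ 1 + 1 + |y| := by
      refine (norm_sub_le _ _).trans (add_le_add ((norm_sub_le _ _).trans ?_) hn.le)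
      rw [Complex.norm_exp_ofReal_mul_I, norm_one]
    rw [← sq_abs]
    nlinarith

lemma norm_cexp_sub_taylor_le {y : ℝ} (hy : |y| ≤ 1) :
    ‖Complex.exp (y * Complex.I) - 1 - y * Complex.I + y ^ 2 / 2‖ ≤ |y| ^ 3 := by
  have hn : ‖(y : ℂ) * Complex.I‖ = |y| := by simp
  have h := Complex.exp_bound (x := y * Complex.I) (by rwa [hn]) (n := 3) (by norm_num)
  rw [hn] at h
  have he : Complex.exp (y * Complex.I) - ∑ m ∈ Finset.range 3,
      ((y : ℂ) * Complex.I) ^ m / (m.factorial : ℂ) =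
      Complex.exp (y * Complex.I) - 1 - y * Complex.I + y ^ 2 / 2 := by
    simp [Finset.sum_range_succ, mul_pow, Nat.factorial]
    ring
  rw [he] at h
  refine h.trans ?_
  have : (0 : ℝ) ≤ |y| ^ 3 := by positivity
  norm_num [Nat.factorial]
  linarith

/-- The second-order behaviour of `exp (i y) - 1 - i y` on the scale `y ~ n^{-1/2}`. -/
lemma tendsto_mul_cexp_remainder {z : ℕ → ℝ} {z₀ : ℝ} (hz : Tendsto z atTop (𝓝 z₀)) :
    Tendsto (fun n : ℕ => (n : ℂ) * (Complex.exp (((√n)⁻¹ * z n : ℝ) * Complex.I) - 1 -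
      ((√n)⁻¹ * z n : ℝ) * Complex.I)) atTop (𝓝 (-(z₀ : ℂ) ^ 2 / 2)) := by
  have hs : Tendsto (fun n : ℕ => (√(n : ℝ))⁻¹) atTop (𝓝 0) :=
    tendsto_inv_atTop_zero.comp (Real.tendsto_sqrt_atTop.comp tendsto_natCast_atTop_atTop)
  have hy : Tendsto (fun n : ℕ => (√(n : ℝ))⁻¹ * z n) atTop (𝓝 0) := by simpa using hs.mul hz
  have h1 : Tendsto (fun n : ℕ => -(z n : ℂ) ^ 2 / 2) atTop (𝓝 (-(z₀ : ℂ) ^ 2 / 2)) :=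
    ((((Complex.continuous_ofReal.tendsto z₀).comp hz).pow 2).neg).div_const 2
  have h2 : Tendsto (fun n : ℕ => (√(n : ℝ))⁻¹ * |z n| ^ 3) atTop (𝓝 0) := by
    simpa using hs.mul (hz.abs.pow 3)
  have h3 : Tendsto (fun n : ℕ => (n : ℂ) * (Complex.exp (((√n)⁻¹ * z n : ℝ) * Complex.I) - 1 -
      ((√n)⁻¹ * z n : ℝ) * Complex.I) - (-(z n : ℂ) ^ 2 / 2)) atTop (𝓝 0) := by
    refine squeeze_zero_norm' ?_ h2
    have hle : ∀ᶠ n : ℕ in atTop, |(√(n : ℝ))⁻¹ * z n| ≤ 1 := by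
      have := hy.abs
      rw [abs_zero] at this
      exact this.eventually (ge_mem_nhds one_pos)
    filter_upwards [hle, eventually_gt_atTop 0] with n hn hn0
    have hn0' : (0 : ℝ) < n := by exact_mod_cast hn0
    have hsq : √(n : ℝ) ^ 2 = n := Real.sq_sqrt hn0'.le
    have hsp : 0 < √(n : ℝ) := Real.sqrt_pos.2 hn0'
    have heq : (n : ℂ) * (Complex.exp (((√n)⁻¹ * z n : ℝ) * Complex.I) - 1 -
        ((√n)⁻¹ * z n : ℝ) * Complex.I) - (-(z n : ℂ) ^ 2 / 2) =
        (n : ℂ) * (Complex.exp (((√n)⁻¹ * z n : ℝ) * Complex.I) - 1 -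
        ((√n)⁻¹ * z n : ℝ) * Complex.I + (((√n)⁻¹ * z n : ℝ) : ℂ) ^ 2 / 2) := by
      have : (n : ℂ) * (((√n)⁻¹ * z n : ℝ) : ℂ) ^ 2 = (z n : ℂ) ^ 2 := by
        rw [← Complex.ofReal_natCast, ← Complex.ofReal_pow, ← Complex.ofReal_mul,
          ← Complex.ofReal_pow]
        congr 1
        rw [mul_pow, inv_pow, hsq]
        field_simp
      linear_combination -this / 2
    rw [heq, norm_mul, Complex.norm_natCast]
    refine (mul_le_mul_of_nonneg_left (norm_cexp_sub_taylor_le hn) hn0'.le).trans (le_of_eq ?_)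
    rw [abs_mul, abs_of_pos (inv_pos.2 hsp), mul_pow]
    nth_rewrite 1 [← hsq]
    field_simp
  simpa using h3.add h1

/-- The characteristic function form of the central limit theorem for triangular arrays whose
`n`-th row is i.i.d. with density `q n`. Instead of Lindeberg's condition, the variables and the
densities converge almost everywhere and the second moments converge to that of the limit. -/
lemma tendsto_charFun_pow {μ : Measure X} {q : ℕ → X → ℝ} {q₀ : X → ℝ} {Z : ℕ → X → ℝ}
    {Z₀ : X → ℝ} (hqi : ∀ n, Integrable (q n) μ) (hq0 : ∀ n x, 0 ≤ q n x)
    (hq1 : ∀ n, ∫ x, q n x ∂μ = 1) (hZm : ∀ n, AEStronglyMeasurable (Z n) μ)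
    (hZi : ∀ n, Integrable (fun x => Z n x * q n x) μ) (hZ0 : ∀ n, ∫ x, Z n x * q n x ∂μ = 0)
    (hZ2 : ∀ n, Integrable (fun x => Z n x ^ 2 * q n x) μ)
    (hZ₀ : Integrable (fun x => Z₀ x ^ 2 * q₀ x) μ)
    (hlim : ∀ᵐ x ∂μ, Tendsto (fun n => Z n x) atTop (𝓝 (Z₀ x)) ∧
      Tendsto (fun n => q n x) atTop (𝓝 (q₀ x)))
    (hvar : Tendsto (fun n => ∫ x, Z n x ^ 2 * q n x ∂μ) atTop
      (𝓝 (∫ x, Z₀ x ^ 2 * q₀ x ∂μ))) :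
    Tendsto (fun n : ℕ => (∫ x, Complex.exp (((√n)⁻¹ * Z n x : ℝ) * Complex.I) * q n x ∂μ) ^ n)
      atTop (𝓝 (Complex.exp (-(∫ x, Z₀ x ^ 2 * q₀ x ∂μ : ℝ) / 2))) := by
  set R : ℕ → X → ℂ := fun n x => Complex.exp (((√n)⁻¹ * Z n x : ℝ) * Complex.I) - 1 -
      ((√n)⁻¹ * Z n x : ℝ) * Complex.I with hR
  have hqm : ∀ n, AEStronglyMeasurable (fun x => (q n x : ℂ)) μ := fun n =>
    (hqi n).ofReal.aestronglyMeasurable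
  have hYm : ∀ n : ℕ, AEStronglyMeasurable (fun x => (((√n)⁻¹ * Z n x : ℝ) : ℂ) * Complex.I) μ :=
    fun n => ((Complex.continuous_ofReal.comp_aestronglyMeasurable
      ((hZm n).const_mul _))).mul_const _
  have hem : ∀ n : ℕ, AEStronglyMeasurable
      (fun x => Complex.exp ((((√n)⁻¹ * Z n x : ℝ) : ℂ) * Complex.I)) μ := fun n =>
    Complex.continuous_exp.comp_aestronglyMeasurable (hYm n)
  have hRm : ∀ n, AEStronglyMeasurable (R n) μ := fun n =>
    ((hem n).sub aestronglyMeasurable_const).sub (hYm n)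
  have hmain : Tendsto (fun n : ℕ => ∫ x, (n : ℂ) * R n x * q n x ∂μ) atTop
      (𝓝 (∫ x, -(Z₀ x : ℂ) ^ 2 / 2 * q₀ x ∂μ)) := by
    refine tendsto_integral_of_dominated_tendsto (G := fun n x => 3 * (Z n x ^ 2 * q n x))
      (g := fun x => 3 * (Z₀ x ^ 2 * q₀ x))
      (fun n => ((hRm n).const_mul _).mul (hqm n)) (fun n => (hZ2 n).const_mul 3)
      (hZ₀.const_mul 3) (fun n => .of_forall fun x => ?_) ?_ ?_ ?_
    · rw [norm_mul, norm_mul, Complex.norm_natCast, Complex.norm_real, Real.norm_of_nonneg (hq0 n x),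
        ← mul_assoc]
      refine mul_le_mul_of_nonneg_right ?_ (hq0 n x)
      rcases Nat.eq_zero_or_pos n with rfl | hn0
      · simp; positivity
      · have hn0' : (0 : ℝ) < n := by exact_mod_cast hn0
        have hsq : √(n : ℝ) ^ 2 = n := Real.sq_sqrt hn0'.le
        refine (mul_le_mul_of_nonneg_left (norm_cexp_sub_one_sub_le _) hn0'.le).trans
          (le_of_eq ?_)
        rw [mul_pow, inv_pow, hsq]
        field_simp
    · filter_upwards [hlim] with x hx
      exact (tendsto_mul_cexp_remainder hx.1).mul
        ((Complex.continuous_ofReal.tendsto _).comp hx.2)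
    · filter_upwards [hlim] with x hx
      exact ((hx.1.pow 2).mul hx.2).const_mul 3
    · simp_rw [integral_const_mul]
      exact hvar.const_mul 3
  have hlimit : ∫ x, -(Z₀ x : ℂ) ^ 2 / 2 * q₀ x ∂μ =
      -((∫ x, Z₀ x ^ 2 * q₀ x ∂μ : ℝ) : ℂ) / 2 := by
    have : ∀ x, -(Z₀ x : ℂ) ^ 2 / 2 * q₀ x = (-1 / 2 : ℂ) * ((Z₀ x ^ 2 * q₀ x : ℝ) : ℂ) := by
      intro x; push_cast; ring
    simp_rw [this]
    rw [integral_const_mul, integral_complex_ofReal]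
    ring
  have hei : ∀ n : ℕ, Integrable (fun x => Complex.exp ((((√n)⁻¹ * Z n x : ℝ) : ℂ) * Complex.I) *
      q n x) μ := fun n => by
    refine (hqi n).norm.mono' ((hem n).mul (hqm n)) (.of_forall fun x => ?_)
    rw [norm_mul, Complex.norm_exp_ofReal_mul_I, one_mul, Complex.norm_real]
  have hsplit : ∀ n : ℕ, ∫ x, (n : ℂ) * R n x * q n x ∂μ =
      n * ((∫ x, Complex.exp (((√n)⁻¹ * Z n x : ℝ) * Complex.I) * q n x ∂μ) - 1) := by
    intro n
    have h1 : ∀ x, (n : ℂ) * R n x * q n x = n * (Complex.exp (((√n)⁻¹ * Z n x : ℝ) * Complex.I) *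
        q n x - ((q n x : ℝ) : ℂ) - (((√n)⁻¹ : ℝ) * Complex.I) * ((Z n x * q n x : ℝ) : ℂ)) := by
      intro x; simp only [hR]; push_cast; ring
    simp_rw [h1]
    have hi1 : Integrable (fun x => Complex.exp (((√n)⁻¹ * Z n x : ℝ) * Complex.I) * q n x -
        ((q n x : ℝ) : ℂ)) μ := (hei n).sub (hqi n).ofReal
    have hi2 : Integrable (fun x => (((√n)⁻¹ : ℝ) * Complex.I) * ((Z n x * q n x : ℝ) : ℂ)) μ :=
      (hZi n).ofReal.const_mul _
    have hi3 : Integrable (fun x => ((q n x : ℝ) : ℂ)) μ := (hqi n).ofReal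
    rw [integral_const_mul, integral_sub hi1 hi2, integral_sub (hei n) hi3, integral_const_mul, integral_complex_ofReal,
      integral_complex_ofReal, hZ0, hq1]
    simp
  rw [hlimit] at hmain
  simp_rw [hsplit] at hmain
  have := Complex.tendsto_one_add_pow_exp_of_tendsto hmain
  simpa using this

/-- Multivariate central limit theorem, in characteristic function form, for triangular arrays
whose `n`-th row is i.i.d. with density `q n`. -/
lemma tendsto_charFun_sum {p : ℕ} {μ : Measure X} {q : ℕ → X → ℝ} {q₀ : X → ℝ}
    {Z : ℕ → X → Fin p → ℝ} {Z₀ : X → Fin p → ℝ} {S : Matrix (Fin p) (Fin p) ℝ}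
    (hqm : ∀ n, Measurable (q n)) (hq0 : ∀ n x, 0 ≤ q n x)
    (hq1 : ∀ n, ∫⁻ x, ENNReal.ofReal (q n x) ∂μ = 1)
    (hZm : ∀ n j, AEStronglyMeasurable (fun x => Z n x j) μ)
    (hZi : ∀ n j, Integrable (fun x => Z n x j * q n x) μ)
    (hZ0 : ∀ n j, ∫ x, Z n x j * q n x ∂μ = 0)
    (hZ2 : ∀ n j k, Integrable (fun x => Z n x j * Z n x k * q n x) μ)
    (hZ₀ : ∀ j k, Integrable (fun x => Z₀ x j * Z₀ x k * q₀ x) μ)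
    (hS : ∀ j k, ∫ x, Z₀ x j * Z₀ x k * q₀ x ∂μ = S j k)
    (hlim : ∀ᵐ x ∂μ, (∀ j, Tendsto (fun n => Z n x j) atTop (𝓝 (Z₀ x j))) ∧
      Tendsto (fun n => q n x) atTop (𝓝 (q₀ x)))
    (hvar : ∀ j k, Tendsto (fun n => ∫ x, Z n x j * Z n x k * q n x ∂μ) atTop (𝓝 (S j k)))
    (t : EuclideanSpace ℝ (Fin p)) :
    Tendsto (fun n : ℕ => charFun ((Measure.pi fun _ : Fin n =>
      μ.withDensity fun x => ENNReal.ofReal (q n x)).map fun x =>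
        WithLp.toLp 2 fun j => (√n)⁻¹ * ∑ i, Z n (x i) j) t) atTop
      (𝓝 (Complex.exp (-(t ⬝ᵥ S *ᵥ t : ℝ) / 2))) := by
  have hqi : ∀ n, Integrable (q n) μ := fun n =>
    ⟨(hqm n).aestronglyMeasurable, by
      rw [hasFiniteIntegral_iff_ofReal (.of_forall (hq0 n)), hq1]; exact ENNReal.one_lt_top⟩
  have hsq : ∀ (z : Fin p → ℝ) (c : ℝ), (∑ j, t j * z j) ^ 2 * c =
      ∑ j, ∑ k, t j * t k * (z j * z k * c) := by
    intro z c
    rw [sq, Finset.sum_mul_sum, Finset.sum_mul]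
    refine Finset.sum_congr rfl fun j _ => ?_
    rw [Finset.sum_mul]
    exact Finset.sum_congr rfl fun k _ => by ring
  have hquad : ∑ j, ∑ k, t j * t k * S j k = t ⬝ᵥ S *ᵥ t := by
    simp only [dotProduct, mulVec, Finset.mul_sum]
    exact Finset.sum_congr rfl fun j _ => Finset.sum_congr rfl fun k _ => by ring
  have hint2 : ∀ n, ∫ x, (∑ j, t j * Z n x j) ^ 2 * q n x ∂μ =
      ∑ j, ∑ k, t j * t k * ∫ x, Z n x j * Z n x k * q n x ∂μ := by
    intro n
    simp_rw [hsq]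
    rw [integral_finsetSum _ fun j _ => integrable_finsetSum _ fun k _ =>
      (hZ2 n j k).const_mul _]
    refine Finset.sum_congr rfl fun j _ => ?_
    rw [integral_finsetSum _ fun k _ => (hZ2 n j k).const_mul _]
    simp_rw [integral_const_mul]
  have hint0 : ∫ x, (∑ j, t j * Z₀ x j) ^ 2 * q₀ x ∂μ = t ⬝ᵥ S *ᵥ t := by
    simp_rw [hsq]
    rw [integral_finsetSum _ fun j _ => integrable_finsetSum _ fun k _ =>
      (hZ₀ j k).const_mul _, ← hquad]
    refine Finset.sum_congr rfl fun j _ => ?_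
    rw [integral_finsetSum _ fun k _ => (hZ₀ j k).const_mul _]
    simp_rw [integral_const_mul, hS]
  have hsum1 : ∀ n x, (∑ j, t j * Z n x j) * q n x = ∑ j, t j * (Z n x j * q n x) := by
    intro n x
    rw [Finset.sum_mul]
    exact Finset.sum_congr rfl fun j _ => by ring
  have key := tendsto_charFun_pow (μ := μ) (q := q) (q₀ := q₀)
    (Z := fun n x => ∑ j, t j * Z n x j) (Z₀ := fun x => ∑ j, t j * Z₀ x j) hqi hq0
    (fun n => by
      rw [integral_eq_lintegral_of_nonneg_ae (.of_forall (hq0 n)) (hqm n).aestronglyMeasurable,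
        hq1, ENNReal.toReal_one])
    (fun n => Finset.aestronglyMeasurable_fun_sum _ fun j _ => (hZm n j).const_mul _)
    (fun n => by
      simp_rw [hsum1]
      exact integrable_finsetSum _ fun j _ => (hZi n j).const_mul _)
    (fun n => by
      simp_rw [hsum1]
      rw [integral_finsetSum _ fun j _ => (hZi n j).const_mul _]
      simp [integral_const_mul, hZ0])
    (fun n => by
      simp_rw [hsq]
      exact integrable_finsetSum _ fun j _ => integrable_finsetSum _ fun k _ =>
        (hZ2 n j k).const_mul _)
    (by
      simp_rw [hsq]
      exact integrable_finsetSum _ fun j _ => integrable_finsetSum _ fun k _ =>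
        (hZ₀ j k).const_mul _)
    (by
      filter_upwards [hlim] with x hx
      exact ⟨tendsto_finsetSum _ fun j _ => (hx.1 j).const_mul _, hx.2⟩)
    (by
      rw [hint0, ← hquad]
      simp_rw [hint2]
      exact tendsto_finsetSum _ fun j _ => tendsto_finsetSum _ fun k _ =>
        (hvar j k).const_mul _)
  rw [hint0] at key
  refine key.congr fun n => ?_
  set P : Measure X := μ.withDensity fun x => ENNReal.ofReal (q n x) with hP
  have hPp : IsProbabilityMeasure P := ⟨by rw [hP, withDensity_apply _ .univ, setLIntegral_univ, hq1]⟩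
  have hZP : AEMeasurable (fun x => (WithLp.toLp 2 (Z n x) : EuclideanSpace ℝ (Fin p))) P := by
    refine (WithLp.measurable_toLp 2 _).comp_aemeasurable (aemeasurable_pi_lambda _ fun j => ?_)
    exact ((hZm n j).mono_ac (withDensity_absolutelyContinuous _ _)).aemeasurable
  have hcoord : ∀ i : Fin n, AEMeasurable (fun x : Fin n → X =>
      (WithLp.toLp 2 (Z n (x i)) : EuclideanSpace ℝ (Fin p))) (Measure.pi fun _ => P) := fun i =>
    hZP.comp_quasiMeasurePreserving (Measure.quasiMeasurePreserving_eval _ i)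
  have hmapi : ∀ i : Fin n, (Measure.pi fun _ : Fin n => P).map (fun x =>
      (WithLp.toLp 2 (Z n (x i)) : EuclideanSpace ℝ (Fin p))) =
      P.map fun x => WithLp.toLp 2 (Z n x) := by
    intro i
    have h1 := (measurePreserving_eval (fun _ : Fin n => P) i).map_eq
    conv_rhs => rw [← h1]
    exact (AEMeasurable.map_map_of_aemeasurable (by rw [h1]; exact hZP)
      (measurable_pi_apply i).aemeasurable).symm
  have hS' : (fun x : Fin n → X => (WithLp.toLp 2 fun j => (√(n : ℝ))⁻¹ * ∑ i, Z n (x i) j :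
      EuclideanSpace ℝ (Fin p))) =
      fun x => (√(n : ℝ))⁻¹ • ∑ i, (WithLp.toLp 2 (Z n (x i)) : EuclideanSpace ℝ (Fin p)) := by
    ext x j
    simp
  rw [hS', charFun_map_smul_comp (Finset.aemeasurable_fun_sum _ fun i _ => hcoord i),
    (iIndepFun_pi (X := fun _ : Fin n => fun x =>
      (WithLp.toLp 2 (Z n x) : EuclideanSpace ℝ (Fin p))) fun _ => hZP).charFun_map_fun_sum_eq_prod
      hcoord]
  simp only [Finset.prod_apply, hmapi, Finset.prod_const, Finset.card_univ, Fintype.card_fin]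
  congr 1
  rw [charFun_apply, integral_map hZP (by fun_prop), hP,
    integral_withDensity_eq_integral_toReal_smul (hqm n).ennreal_ofReal
      (.of_forall fun _ => ENNReal.ofReal_lt_top)]
  refine integral_congr_ae (.of_forall fun x => ?_)
  simp only [ENNReal.toReal_ofReal (hq0 n x), Complex.real_smul]
  rw [mul_comm]
  congr 4
  simp [PiLp.inner_apply, Finset.mul_sum]
  exact Finset.sum_congr rfl fun j _ => by ring

/-- The weak law of large numbers for the product measures `P ^ n`. -/
lemma tendsto_average_whp {P : Measure X} [IsProbabilityMeasure P] {g : X → ℝ}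
    (hg : Integrable g P) :
    Tendsto (fun ω : Σ n, Fin n → X => (ω.1 : ℝ)⁻¹ * ∑ i, g (ω.2 i))
      (whp fun n => Measure.pi fun _ : Fin n => P) (𝓝 (∫ x, g x ∂P)) := by
  obtain ⟨g', hg'm, hgg'⟩ := hg.aestronglyMeasurable
  have hg'm : Measurable g' := hg'm.measurable
  have hg' : Integrable g' P := hg.congr hgg'
  have hae : ∀ᶠ ω in whp fun n => Measure.pi fun _ : Fin n => P,
      (ω.1 : ℝ)⁻¹ * ∑ i, g' (ω.2 i) = (ω.1 : ℝ)⁻¹ * ∑ i, g (ω.2 i) := by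
    refine eventually_whp_of_ae fun n => ?_
    have : ∀ᵐ x ∂Measure.pi fun _ : Fin n => P, ∀ i, g (x i) = g' (x i) :=
      ae_all_iff.2 fun i => (Measure.quasiMeasurePreserving_eval (fun _ : Fin n => P) i).ae hgg'
    filter_upwards [this] with x hx
    simp [hx]
  rw [integral_congr_ae hgg']
  refine Tendsto.congr' hae ?_
  set Q : Measure (ℕ → X) := Measure.infinitePi fun _ => P
  have hind : iIndepFun (fun (i : ℕ) (x : ℕ → X) => g' (x i)) Q :=
    iIndepFun_infinitePi (X := fun _ => g') fun _ => hg'm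
  have heval : ∀ i, MeasurePreserving (fun x : ℕ → X => x i) Q P := fun i =>
    measurePreserving_eval_infinitePi _ i
  have hident : ∀ i, IdentDistrib (fun x : ℕ → X => g' (x i)) (fun x => g' (x 0)) Q Q := by
    intro i
    refine ⟨(hg'm.comp (measurable_pi_apply i)).aemeasurable,
      (hg'm.comp (measurable_pi_apply 0)).aemeasurable, ?_⟩
    have h (i) : Q.map (fun x : ℕ → X => g' (x i)) = P.map g' := by
      rw [← (heval i).map_eq, Measure.map_map hg'm (measurable_pi_apply i)]
      rfl
    rw [h, h]
  have hslln := strong_law_ae_real (μ := Q) (fun i x => g' (x i))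
    ((heval 0).integrable_comp_of_integrable hg') (fun i j hij => hind.indepFun hij) hident
  have hmean : ∫ x, g' (x 0) ∂Q = ∫ x, g' x ∂P := by
    rw [← (heval 0).map_eq, integral_map (measurable_pi_apply 0).aemeasurable
      hg'm.aestronglyMeasurable]
  rw [hmean] at hslln
  have hmeas := tendstoInMeasure_of_tendsto_ae (μ := Q)
    (f := fun n x => (∑ i ∈ Finset.range n, g' (x i)) / (n : ℝ)) (g := fun _ => ∫ x, g' x ∂P)
    (fun n => ((Finset.measurable_sum _ fun i _ =>
      hg'm.comp (measurable_pi_apply i)).div_const _).aestronglyMeasurable) hslln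
  rw [tendstoInMeasure_iff_dist] at hmeas
  rw [Metric.tendsto_nhds]
  intro ε hε
  rw [eventually_whp]
  refine (hmeas ε hε).congr fun n => ?_
  have hmap : Q.map (fun x (i : Fin n) => x i) = Measure.pi fun _ : Fin n => P := by
    rw [Measure.map_infinitePi_infinitePi_of_inj (P := fun _ => P) Fin.val_injective,
      Measure.infinitePi_eq_pi]
  rw [← hmap, Measure.map_apply (by fun_prop)]
  · congr 1
    ext x
    simp only [not_lt, Set.mem_preimage, Set.mem_ofPred_eq]
    rw [Finset.sum_range (fun i => g' (x i)), div_eq_inv_mul]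
  · simp only [not_lt]
    refine measurableSet_le measurable_const (Measurable.dist ?_ measurable_const)
    have hm : ∀ i : Fin n, Measurable fun x : Fin n → X => g' (x i) := fun i =>
      hg'm.comp (measurable_pi_apply i)
    have hs : Measurable fun x : Fin n → X => (n : ℝ)⁻¹ * ∑ i, g' (x i) :=
      (Finset.measurable_fun_sum _ fun i _ => hm i).const_mul _
    exact hs

end LimitTheorems

/-! ### Partial derivatives -/

section PartialDerivatives

variable {p : ℕ} {φ χ : (Fin p → ℝ) → ℝ} {θ : Fin p → ℝ}

lemma pd_congr (j : Fin p) (h : φ =ᶠ[𝓝 θ] χ) : pd j φ θ = pd j χ θ := by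
  simp only [pd, h.fderiv_eq]

lemma pd_const (j : Fin p) (c : ℝ) : pd j (fun _ => c) θ = 0 := by simp [pd]

lemma pd_const_mul (j : Fin p) (c : ℝ) (h : DifferentiableAt ℝ φ θ) :
    pd j (fun θ' => c * φ θ') θ = c * pd j φ θ := by
  simp only [pd, (h.hasFDerivAt.const_mul c).fderiv]
  simp

lemma pd_sub (j : Fin p) (h : DifferentiableAt ℝ φ θ) (h' : DifferentiableAt ℝ χ θ) :
    pd j (fun θ' => φ θ' - χ θ') θ = pd j φ θ - pd j χ θ := by
  simp only [pd, (h.hasFDerivAt.fun_sub h'.hasFDerivAt).fderiv]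
  simp

lemma pd_mul (j : Fin p) (h : DifferentiableAt ℝ φ θ) (h' : DifferentiableAt ℝ χ θ) :
    pd j (fun θ' => φ θ' * χ θ') θ = pd j φ θ * χ θ + φ θ * pd j χ θ := by
  simp only [pd, (h.hasFDerivAt.fun_mul h'.hasFDerivAt).fderiv]
  simp
  ring

lemma pd_rpow (j : Fin p) (c : ℝ) (h : DifferentiableAt ℝ φ θ) (h0 : 0 < φ θ) :
    pd j (fun θ' => φ θ' ^ c) θ = c * (pd j (fun θ' => Real.log (φ θ')) θ * φ θ ^ c) := by
  simp only [pd, (h.hasFDerivAt.rpow_const (Or.inl h0.ne')).fderiv,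
    (h.hasFDerivAt.log h0.ne').fderiv]
  simp only [_root_.smul_apply, smul_eq_mul]
  rw [Real.rpow_sub_one h0.ne']
  field_simp

lemma contDiffOn_pd {n k : WithTop ℕ∞} {ω : Set (Fin p → ℝ)} (hω : IsOpen ω) (j : Fin p)
    (h : ContDiffOn ℝ n φ ω) (hk : k + 1 ≤ n) : ContDiffOn ℝ k (pd j φ) ω :=
  (h.fderiv_of_isOpen hω hk).clm_apply contDiffOn_const

lemma fderiv_apply_eq_sum_pd (v : Fin p → ℝ) : fderiv ℝ φ θ v = ∑ k, pd k φ θ * v k := by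
  conv_lhs => rw [pi_eq_sum_univ' v]
  simp only [map_sum, map_smul, smul_eq_mul, pd]
  refine Finset.sum_congr rfl fun k _ => ?_
  rw [mul_comm]

lemma norm_le_sum_of_apply_eq (A : (Fin p → ℝ) →L[ℝ] ℝ) (a : Fin p → ℝ)
    (h : ∀ v, A v = ∑ k, a k * v k) : ‖A‖ ≤ ∑ k, |a k| := by
  refine A.opNorm_le_bound (Finset.sum_nonneg fun k _ => abs_nonneg _) fun v => ?_
  rw [h, Finset.sum_mul]
  refine (norm_sum_le _ _).trans (Finset.sum_le_sum fun k _ => ?_)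
  rw [norm_mul]
  exact mul_le_mul_of_nonneg_left (norm_le_pi_norm v k) (norm_nonneg _)

/-- A first-order expansion, uniform over the closed ball of radius `ρ` around `θ₀` and with the
derivative frozen at `θ₀`, for a function with bounded second partial derivatives. -/
lemma abs_sub_sub_sum_pd_le {G : (Fin p → ℝ) → ℝ} {B : Fin p → Fin p → ℝ} {θ₀ : Fin p → ℝ} {ρ : ℝ}
    (hG : ∀ θ ∈ Metric.closedBall θ₀ ρ, DifferentiableAt ℝ G θ)
    (hG' : ∀ k, ∀ θ ∈ Metric.closedBall θ₀ ρ, DifferentiableAt ℝ (pd k G) θ)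
    (hB : ∀ k l, ∀ θ ∈ Metric.closedBall θ₀ ρ, |pd l (pd k G) θ| ≤ B k l)
    {θ θ' : Fin p → ℝ} (hθ : θ ∈ Metric.closedBall θ₀ ρ) (hθ' : θ' ∈ Metric.closedBall θ₀ ρ) :
    |G θ - G θ' - ∑ k, pd k G θ₀ * (θ k - θ' k)| ≤ (∑ k, ∑ l, B k l) * ρ * ‖θ - θ'‖ := by
  have hρ : 0 ≤ ρ := dist_nonneg.trans hθ
  have h₀ : θ₀ ∈ Metric.closedBall θ₀ ρ := Metric.mem_closedBall_self hρ
  have hk : ∀ k, ∀ τ ∈ Metric.closedBall θ₀ ρ, |pd k G τ - pd k G θ₀| ≤ (∑ l, B k l) * ρ := by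
    intro k τ hτ
    have h1 := (convex_closedBall θ₀ ρ).norm_image_sub_le_of_norm_fderiv_le (f := pd k G)
      (C := ∑ l, B k l) (hG' k) (fun σ hσ => (norm_le_sum_of_apply_eq _ _ fun v =>
        fderiv_apply_eq_sum_pd v).trans (Finset.sum_le_sum fun l _ => hB k l σ hσ)) h₀ hτ
    refine h1.trans (mul_le_mul_of_nonneg_left ?_
      (Finset.sum_nonneg fun l _ => (abs_nonneg _).trans (hB k l _ h₀)))
    rw [← dist_eq_norm]
    exact hτ
  have h2 := (convex_closedBall θ₀ ρ).norm_image_sub_le_of_norm_fderiv_le' (f := G)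
    (φ := fderiv ℝ G θ₀) (C := (∑ k, ∑ l, B k l) * ρ) hG (fun τ hτ => ?_) hθ' hθ
  · rw [fderiv_apply_eq_sum_pd] at h2
    simpa using h2
  · refine (norm_le_sum_of_apply_eq _ (fun k => pd k G τ - pd k G θ₀) fun v => ?_).trans ?_
    · rw [_root_.sub_apply, fderiv_apply_eq_sum_pd, fderiv_apply_eq_sum_pd,
        ← Finset.sum_sub_distrib]
      exact Finset.sum_congr rfl fun k _ => by ring
    · rw [Finset.sum_mul]
      exact Finset.sum_le_sum fun k _ => hk k τ hτ

end PartialDerivatives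

/-! ### The estimating function of a regular model -/

section Model

variable {p : ℕ} {X : Type*} [MeasurableSpace X]

/-- The centring vector `∫ u_θ f_θ^{1+β} dμ` of the estimating equation. -/
def xi (μ : Measure X) (f : (Fin p → ℝ) → X → ℝ) (β : ℝ) (θ : Fin p → ℝ) : Fin p → ℝ :=
  fun j => ∫ y, score f θ y j * f θ y ^ (1 + β) ∂μ

/-- The summand `u_θ(x) f_θ(x)^β - ∫ u_θ f_θ^{1+β} dμ` of the estimating equation. -/
def estFun (μ : Measure X) (f : (Fin p → ℝ) → X → ℝ) (β : ℝ) (θ : Fin p → ℝ) (x : X) :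
    Fin p → ℝ :=
  fun j => score f θ x j * f θ x ^ β - xi μ f β θ j

lemma integrable_mul_mul_of_sq {μ : Measure X} {a b w : X → ℝ}
    (ha : AEStronglyMeasurable a μ) (hb : AEStronglyMeasurable b μ) (hw : ∀ x, 0 ≤ w x)
    (hwm : AEStronglyMeasurable w μ) (ha2 : Integrable (fun x => a x * a x * w x) μ)
    (hb2 : Integrable (fun x => b x * b x * w x) μ) :
    Integrable (fun x => a x * b x * w x) μ := by
  refine (ha2.add hb2).mono' ((ha.mul hb).mul hwm) (.of_forall fun x => ?_)
  simp only [Pi.add_apply, Real.norm_eq_abs, abs_mul, abs_of_nonneg (hw x)]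
  have h : |a x| * |b x| ≤ a x * a x + b x * b x := by
    nlinarith [sq_nonneg (|a x| - |b x|), sq_abs (a x), sq_abs (b x), sq_nonneg (|a x|),
      sq_nonneg (|b x|)]
  calc |a x| * |b x| * w x ≤ (a x * a x + b x * b x) * w x :=
        mul_le_mul_of_nonneg_right h (hw x)
    _ = _ := by ring

variable {μ : Measure X} {Θ : Set (Fin p → ℝ)} {f : (Fin p → ℝ) → X → ℝ} {β : ℝ}
  {θ₀ : Fin p → ℝ} {ω : Set (Fin p → ℝ)}

lemma J_apply (θ : Fin p → ℝ) (j k : Fin p) :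
    J μ f β θ j k = ∫ x, score f θ x j * score f θ x k * f θ x ^ (1 + β) ∂μ := by
  simp [J, JMat]

lemma rpow_one_add {y : ℝ} (hβ : 0 ≤ β) (hy : 0 ≤ y) : y ^ (1 + β) = y ^ β * y := by
  rw [Real.rpow_add_of_nonneg hy zero_le_one hβ, Real.rpow_one, mul_comm]

lemma IsDensityFamily.integrable (hf : IsDensityFamily μ Θ f) {θ : Fin p → ℝ} (hθ : θ ∈ Θ) :
    Integrable (f θ) μ :=
  ⟨(hf.measurable θ hθ).aestronglyMeasurable, by
    rw [hasFiniteIntegral_iff_ofReal (.of_forall (hf.nonneg θ hθ)), hf.lintegral_eq_one θ hθ]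
    exact ENNReal.one_lt_top⟩

lemma IsDensityFamily.integral_eq_one (hf : IsDensityFamily μ Θ f) {θ : Fin p → ℝ}
    (hθ : θ ∈ Θ) : ∫ x, f θ x ∂μ = 1 := by
  rw [integral_eq_lintegral_of_nonneg_ae (.of_forall (hf.nonneg θ hθ))
    (hf.measurable θ hθ).aestronglyMeasurable, hf.lintegral_eq_one θ hθ, ENNReal.toReal_one]

namespace Regularity

variable (hf : IsDensityFamily μ Θ f) (hβ : 0 ≤ β)
  (hreg : Regularity μ Θ f β (f θ₀) θ₀ ω)

include hreg in
lemma pos {θ : Fin p → ℝ} (hθ : θ ∈ ω) {x : X} (hx : 0 < f θ₀ x) : 0 < f θ x :=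
  (hreg.support θ (hreg.subset hθ) x).2 hx

include hf hreg in
lemma eq_zero {θ : Fin p → ℝ} (hθ : θ ∈ ω) {x : X} (hx : ¬ 0 < f θ₀ x) : f θ x = 0 :=
  le_antisymm (not_lt.1 fun h => hx ((hreg.support θ (hreg.subset hθ) x).1 h))
    (hf.nonneg θ (hreg.subset hθ) x)

include hf hreg in
/-- Off the common support the model vanishes identically on `ω`, and the score is `0` there
because `Real.log 0 = 0`. -/
lemma score_eq_zero {θ : Fin p → ℝ} (hθ : θ ∈ ω) {x : X} (hx : ¬ 0 < f θ₀ x) (j : Fin p) :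
    score f θ x j = 0 := by
  have : (fun θ' => Real.log (f θ' x)) =ᶠ[𝓝 θ] fun _ => 0 := by
    filter_upwards [hreg.isOpen.mem_nhds hθ] with θ' hθ'
    rw [hreg.eq_zero hf hθ' hx, Real.log_zero]
  rw [score, pd_congr j this, pd_const]

include hreg in
lemma differentiableAt {θ : Fin p → ℝ} (hθ : θ ∈ ω) {x : X}
    (hs : ContDiffOn ℝ 3 (fun θ => f θ x) ω) : DifferentiableAt ℝ (fun θ => f θ x) θ :=
  (hs.differentiableOn (by norm_num)).differentiableAt (hreg.isOpen.mem_nhds hθ)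

include hreg in
lemma contDiffOn_score {x : X} (hs : ContDiffOn ℝ 3 (fun θ => f θ x) ω) (hx : 0 < f θ₀ x)
    (j : Fin p) : ContDiffOn ℝ 2 (fun θ => score f θ x j) ω :=
  contDiffOn_pd hreg.isOpen j (hs.log fun _ hθ => (hreg.pos hθ hx).ne') (by norm_num)

include hreg in
lemma contDiffOn_score_mul {x : X} (hs : ContDiffOn ℝ 3 (fun θ => f θ x) ω) (hx : 0 < f θ₀ x)
    (j : Fin p) : ContDiffOn ℝ 2 (fun θ => score f θ x j * f θ x ^ β) ω :=
  (hreg.contDiffOn_score hs hx j).mul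
    ((hs.of_le (by norm_num)).rpow_const_of_ne fun _ hθ => (hreg.pos hθ hx).ne')

include hf hβ hreg in
lemma pd_rpow_model {θ : Fin p → ℝ} (hθ : θ ∈ ω) {x : X}
    (hs : ContDiffOn ℝ 3 (fun θ => f θ x) ω) (j : Fin p) :
    pd j (fun θ' => f θ' x ^ (1 + β)) θ = (1 + β) * (score f θ x j * f θ x ^ (1 + β)) := by
  by_cases hx : 0 < f θ₀ x
  · exact pd_rpow j _ (hreg.differentiableAt hθ hs) (hreg.pos hθ hx)
  · have : (fun θ' => f θ' x ^ (1 + β)) =ᶠ[𝓝 θ] fun _ => 0 := by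
      filter_upwards [hreg.isOpen.mem_nhds hθ] with θ' hθ'
      rw [hreg.eq_zero hf hθ' hx, Real.zero_rpow (by positivity)]
    rw [pd_congr j this, pd_const, hreg.score_eq_zero hf hθ hx]
    simp

include hf hβ hreg in
lemma integrable_score_mul {θ : Fin p → ℝ} (hθ : θ ∈ ω) (j : Fin p) :
    Integrable (fun x => score f θ x j * f θ x ^ (1 + β)) μ := by
  have h := ((hreg.diff_model.2 j).1 θ hθ).1.const_mul (1 + β)⁻¹
  refine h.congr ?_
  filter_upwards [hreg.smooth] with x hs
  rw [hreg.pd_rpow_model hf hβ hθ hs]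
  field_simp

include hf hβ hreg in
lemma aestronglyMeasurable_score {θ : Fin p → ℝ} (hθ : θ ∈ ω) (j : Fin p) :
    AEStronglyMeasurable (fun x => score f θ x j) μ := by
  have h1 := (hreg.integrable_score_mul hf hβ hθ j).aestronglyMeasurable
  have h2 : Measurable fun x => f θ x ^ (1 + β) :=
    (hf.measurable θ (hreg.subset hθ)).pow_const _
  refine (h1.mul h2.inv.aestronglyMeasurable).congr (.of_forall fun x => ?_)
  simp only [Pi.mul_apply, Pi.inv_apply]
  by_cases hx : 0 < f θ₀ x
  · have : f θ x ^ (1 + β) ≠ 0 := (Real.rpow_pos_of_pos (hreg.pos hθ hx) _).ne'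
    field_simp
  · rw [hreg.score_eq_zero hf hθ hx]
    simp

include hf hβ hreg in
lemma integral_pd_model {θ : Fin p → ℝ} (hθ : θ ∈ ω) (j : Fin p) :
    ∫ x, pd j (fun θ' => f θ' x ^ (1 + β)) θ ∂μ = (1 + β) * xi μ f β θ j := by
  rw [xi, ← integral_const_mul]
  refine integral_congr_ae ?_
  filter_upwards [hreg.smooth] with x hs
  rw [hreg.pd_rpow_model hf hβ hθ hs]

include hf hβ hreg in
lemma xi_eventuallyEq {θ : Fin p → ℝ} (hθ : θ ∈ ω) (j : Fin p) :
    (fun θ' => xi μ f β θ' j) =ᶠ[𝓝 θ]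
      fun θ' => (1 + β)⁻¹ * ∫ x, pd j (fun θ' => f θ' x ^ (1 + β)) θ' ∂μ := by
  filter_upwards [hreg.isOpen.mem_nhds hθ] with θ' hθ'
  rw [hreg.integral_pd_model hf hβ hθ']
  field_simp

include hf hβ hreg in
lemma differentiableAt_xi {θ : Fin p → ℝ} (hθ : θ ∈ ω) (j : Fin p) :
    DifferentiableAt ℝ (fun θ' => xi μ f β θ' j) θ :=
  (((hreg.diff_model.2 j).1 θ hθ).2.1.const_mul _).congr_of_eventuallyEq
    (hreg.xi_eventuallyEq hf hβ hθ j)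

include hf hβ hreg in
lemma pd_xi {θ : Fin p → ℝ} (hθ : θ ∈ ω) (j k : Fin p) :
    pd k (fun θ' => xi μ f β θ' j) θ = (1 + β)⁻¹ *
      ∫ x, pd k (fun θ₁ => pd j (fun θ' => f θ' x ^ (1 + β)) θ₁) θ ∂μ := by
  rw [pd_congr k (hreg.xi_eventuallyEq hf hβ hθ j),
    pd_const_mul k _ ((hreg.diff_model.2 j).1 θ hθ).2.1, ((hreg.diff_model.2 j).1 θ hθ).2.2 k]

include hf hβ hreg in
lemma differentiableAt_pd_xi {θ : Fin p → ℝ} (hθ : θ ∈ ω) (j k : Fin p) :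
    DifferentiableAt ℝ (pd k fun θ' => xi μ f β θ' j) θ := by
  refine ((((hreg.diff_model.2 j).2 k).1 θ hθ).2.1.const_mul
    (1 + β)⁻¹).congr_of_eventuallyEq ?_
  filter_upwards [hreg.isOpen.mem_nhds hθ] with θ' hθ'
  exact hreg.pd_xi hf hβ hθ' j k

include hf hβ hreg in
/-- The gradient of `V` is `-(1 + β)` times the summand of the estimating equation. -/
lemma pd_V {θ : Fin p → ℝ} (hθ : θ ∈ ω) {x : X} (hs : ContDiffOn ℝ 3 (fun θ => f θ x) ω)
    (hx : 0 < f θ₀ x) (j : Fin p) :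
    pd j (fun θ' => V μ f β θ' x) θ = -(1 + β) * estFun μ f β θ x j := by
  have hF : pd j (fun θ' => ∫ x, f θ' x ^ (1 + β) ∂μ) θ = (1 + β) * xi μ f β θ j := by
    rw [(hreg.diff_model.1 θ hθ).2.2 j, hreg.integral_pd_model hf hβ hθ]
  have hd := hreg.differentiableAt hθ hs
  have hp := hreg.pos hθ hx
  by_cases h0 : β = 0
  · subst h0
    -- For `β = 0` the centring vector is the gradient of `∫ f_θ dμ = 1`.
    have hone : (fun θ' => ∫ x, f θ' x ^ (1 + (0 : ℝ)) ∂μ) =ᶠ[𝓝 θ] fun _ => 1 := by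
      filter_upwards [hreg.isOpen.mem_nhds hθ] with θ' hθ'
      simp only [add_zero, Real.rpow_one]
      exact hf.integral_eq_one (hreg.subset hθ')
    rw [pd_congr j hone, pd_const] at hF
    have hxi : xi μ f 0 θ j = 0 := by linarith
    have hV : (fun θ' => V μ f 0 θ' x) = fun θ' => (-1) * Real.log (f θ' x) := by
      ext θ'; simp [V]
    rw [hV, pd_const_mul j _ (hd.log hp.ne')]
    simp [estFun, hxi, score]
  · have hV : (fun θ' => V μ f β θ' x) = fun θ' =>
        (∫ y, f θ' y ^ (1 + β) ∂μ) - (1 + 1 / β) * f θ' x ^ β := by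
      ext θ'; simp [V, h0]
    have hdr : DifferentiableAt ℝ (fun θ' => f θ' x ^ β) θ :=
      (hd.hasFDerivAt.rpow_const (Or.inl hp.ne')).differentiableAt
    rw [hV, pd_sub j (hreg.diff_model.1 θ hθ).2.1 (hdr.const_mul _), hF,
      pd_const_mul j _ hdr, pd_rpow j β hd hp]
    simp only [estFun, score]
    field_simp
    ring

include hreg in
lemma differentiableAt_score_mul {θ : Fin p → ℝ} (hθ : θ ∈ ω) {x : X}
    (hs : ContDiffOn ℝ 3 (fun θ => f θ x) ω) (hx : 0 < f θ₀ x) (j : Fin p) :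
    DifferentiableAt ℝ (fun θ' => score f θ' x j * f θ' x ^ β) θ :=
  ((hreg.contDiffOn_score_mul hs hx j).differentiableOn (by norm_num)).differentiableAt
    (hreg.isOpen.mem_nhds hθ)

include hf hβ hreg in
lemma pd_V_eventuallyEq {θ : Fin p → ℝ} (hθ : θ ∈ ω) {x : X}
    (hs : ContDiffOn ℝ 3 (fun θ => f θ x) ω) (hx : 0 < f θ₀ x) (j : Fin p) :
    (pd j fun θ' => V μ f β θ' x) =ᶠ[𝓝 θ] fun θ' =>
      -(1 + β) * (score f θ' x j * f θ' x ^ β - xi μ f β θ' j) := by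
  filter_upwards [hreg.isOpen.mem_nhds hθ] with θ' hθ'
  exact hreg.pd_V hf hβ hθ' hs hx j

include hf hβ hreg in
lemma differentiableAt_pd_V {θ : Fin p → ℝ} (hθ : θ ∈ ω) {x : X}
    (hs : ContDiffOn ℝ 3 (fun θ => f θ x) ω) (hx : 0 < f θ₀ x) (j : Fin p) :
    DifferentiableAt ℝ (pd j fun θ' => V μ f β θ' x) θ :=
  (((hreg.differentiableAt_score_mul hθ hs hx j).sub
    (hreg.differentiableAt_xi hf hβ hθ j)).const_mul _).congr_of_eventuallyEq
    (hreg.pd_V_eventuallyEq hf hβ hθ hs hx j)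

include hf hβ hreg in
lemma pd_pd_V {θ : Fin p → ℝ} (hθ : θ ∈ ω) {x : X}
    (hs : ContDiffOn ℝ 3 (fun θ => f θ x) ω) (hx : 0 < f θ₀ x) (j k : Fin p) :
    pd k (pd j fun θ' => V μ f β θ' x) θ = -(1 + β) *
      (pd k (fun θ' => score f θ' x j * f θ' x ^ β) θ - pd k (fun θ' => xi μ f β θ' j) θ) := by
  have h1 := hreg.differentiableAt_score_mul (β := β) hθ hs hx j
  have h2 := hreg.differentiableAt_xi hf hβ hθ j
  rw [pd_congr k (hreg.pd_V_eventuallyEq hf hβ hθ hs hx j), pd_const_mul k _ (h1.fun_sub h2),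
    pd_sub k h1 h2]

include hf hβ hreg in
lemma differentiableAt_pd_pd_V {θ : Fin p → ℝ} (hθ : θ ∈ ω) {x : X}
    (hs : ContDiffOn ℝ 3 (fun θ => f θ x) ω) (hx : 0 < f θ₀ x) (j k : Fin p) :
    DifferentiableAt ℝ (pd k (pd j fun θ' => V μ f β θ' x)) θ := by
  have h1 : DifferentiableAt ℝ (pd k fun θ' => score f θ' x j * f θ' x ^ β) θ :=
    ((contDiffOn_pd (k := 1) hreg.isOpen k (hreg.contDiffOn_score_mul hs hx j)
      (by norm_num)).differentiableOn (by norm_num)).differentiableAt (hreg.isOpen.mem_nhds hθ)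
  refine ((h1.sub (hreg.differentiableAt_pd_xi hf hβ hθ j k)).const_mul
    (-(1 + β))).congr_of_eventuallyEq ?_
  filter_upwards [hreg.isOpen.mem_nhds hθ] with θ' hθ'
  exact hreg.pd_pd_V hf hβ hθ' hs hx j k

include hβ hreg in
/-- The product rule for `(u_θ f_θ^β) f_θ = (1 + β)⁻¹ ∂_j f_θ^{1+β}`. -/
lemma pd_score_mul {θ : Fin p → ℝ} (hθ : θ ∈ ω) {x : X}
    (hs : ContDiffOn ℝ 3 (fun θ => f θ x) ω) (hx : 0 < f θ₀ x) (j k : Fin p) :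
    pd k (fun θ' => score f θ' x j * f θ' x ^ β) θ * f θ x =
      (1 + β)⁻¹ * pd k (fun θ₁ => pd j (fun θ' => f θ' x ^ (1 + β)) θ₁) θ -
        score f θ x j * score f θ x k * f θ x ^ (1 + β) := by
  have hd := hreg.differentiableAt hθ hs
  have h1 := hreg.differentiableAt_score_mul (β := β) hθ hs hx j
  have hb : (1 + β) ≠ 0 := by positivity
  have heq : (fun θ₁ => pd j (fun θ' => f θ' x ^ (1 + β)) θ₁) =ᶠ[𝓝 θ] fun θ' =>
      (1 + β) * ((score f θ' x j * f θ' x ^ β) * f θ' x) := by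
    filter_upwards [hreg.isOpen.mem_nhds hθ] with θ' hθ'
    rw [pd_rpow j _ (hreg.differentiableAt hθ' hs) (hreg.pos hθ' hx),
      rpow_one_add hβ (hreg.pos hθ' hx).le, score]
    ring
  have hk : pd k (fun θ' => f θ' x) θ = score f θ x k * f θ x := by
    have := pd_rpow k 1 hd (hreg.pos hθ hx)
    simpa [score] using this
  rw [pd_congr k heq, pd_const_mul k _ (h1.fun_mul hd), pd_mul k h1 hd, hk,
    rpow_one_add hβ (hreg.pos hθ hx).le]
  field_simp
  ring

include hf hβ hreg in
lemma integrable_score_mul_score (j k : Fin p) :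
    Integrable (fun x => score f θ₀ x j * score f θ₀ x k * f θ₀ x ^ (1 + β)) μ := by
  have h : ∀ j, Integrable (fun x => score f θ₀ x j * score f θ₀ x j * f θ₀ x ^ (1 + β)) μ := by
    intro j
    -- The diagonal of `J` is positive, so its integrals are not the junk value `0`.
    refine not_imp_comm.1 integral_undef ?_
    have := hreg.posDef.diag_pos (i := j)
    change 0 < J μ f β θ₀ j j at this
    rw [J_apply] at this
    exact this.ne'
  exact integrable_mul_mul_of_sq (hreg.aestronglyMeasurable_score hf hβ hreg.mem j)
    (hreg.aestronglyMeasurable_score hf hβ hreg.mem k)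
    (fun x => Real.rpow_nonneg (hf.nonneg _ (hreg.subset hreg.mem) x) _)
    ((hf.measurable _ (hreg.subset hreg.mem)).pow_const _).aestronglyMeasurable (h j) (h k)

include hf hβ hreg in
/-- The expectation of the Hessian of `V` at the true parameter is `(1 + β) J`. -/
lemma integral_pd_pd_V (j k : Fin p) :
    Integrable (fun x => pd k (pd j fun θ' => V μ f β θ' x) θ₀ * f θ₀ x) μ ∧
    ∫ x, pd k (pd j fun θ' => V μ f β θ' x) θ₀ * f θ₀ x ∂μ = (1 + β) * J μ f β θ₀ j k := by
  have h1 : Integrable (fun x => pd k (fun θ₁ => pd j (fun θ' => f θ' x ^ (1 + β)) θ₁) θ₀) μ :=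
    (((hreg.diff_model.2 j).2 k).1 θ₀ hreg.mem).1
  have h2 := hreg.integrable_score_mul_score hf hβ j k
  have hΘ := hreg.subset hreg.mem
  have hfi := hf.integrable hΘ
  have hf1 := hf.integral_eq_one hΘ
  have hb : (1 + β) ≠ 0 := by positivity
  have hae : (fun x => pd k (pd j fun θ' => V μ f β θ' x) θ₀ * f θ₀ x) =ᵐ[μ] fun x =>
      (1 + β) * (pd k (fun θ' => xi μ f β θ' j) θ₀ * f θ₀ x -
        ((1 + β)⁻¹ * pd k (fun θ₁ => pd j (fun θ' => f θ' x ^ (1 + β)) θ₁) θ₀ -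
        score f θ₀ x j * score f θ₀ x k * f θ₀ x ^ (1 + β))) := by
    filter_upwards [hreg.smooth] with x hs
    by_cases hx : 0 < f θ₀ x
    · rw [hreg.pd_pd_V hf hβ hreg.mem hs hx, ← hreg.pd_score_mul hβ hreg.mem hs hx]
      ring
    · have hz : (fun θ₁ => pd j (fun θ' => f θ' x ^ (1 + β)) θ₁) =ᶠ[𝓝 θ₀] fun _ => 0 := by
        filter_upwards [hreg.isOpen.mem_nhds hreg.mem] with θ' hθ'
        rw [hreg.pd_rpow_model hf hβ hθ' hs, hreg.score_eq_zero hf hθ' hx]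
        simp
      rw [pd_congr k hz, pd_const, hreg.eq_zero hf hreg.mem hx,
        hreg.score_eq_zero hf hreg.mem hx]
      simp
  have hi3 : Integrable (fun x => (1 + β)⁻¹ *
      pd k (fun θ₁ => pd j (fun θ' => f θ' x ^ (1 + β)) θ₁) θ₀ -
        score f θ₀ x j * score f θ₀ x k * f θ₀ x ^ (1 + β)) μ := (h1.const_mul _).sub h2
  have hi4 := hfi.const_mul (pd k (fun θ' => xi μ f β θ' j) θ₀)
  refine ⟨((hi4.sub hi3).const_mul _).congr hae.symm, ?_⟩
  rw [integral_congr_ae hae, integral_const_mul, integral_sub hi4 hi3,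
    integral_sub (h1.const_mul _) h2, integral_const_mul, integral_const_mul, hf1,
    hreg.pd_xi hf hβ hreg.mem, J_apply]
  ring

/-- The parameters at which the estimating function has finite second moments. -/
def goodSet (μ : Measure X) (f : (Fin p → ℝ) → X → ℝ) (β : ℝ) (ω : Set (Fin p → ℝ)) :
    Set (Fin p → ℝ) :=
  {θ | θ ∈ ω ∧ ∀ j, Integrable
    (fun x => score f θ x j * score f θ x j * (f θ x ^ (2 * β) * f θ x)) μ}

include hreg in
lemma goodSet_mem_nhds (hK : ContinuousAt (K μ f β) θ₀) (hKpos : (K μ f β θ₀).PosDef) :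
    goodSet μ f β ω ∈ 𝓝 θ₀ := by
  have h : ∀ j, ∀ᶠ θ in 𝓝 θ₀, 0 < K μ f β θ j j := fun j =>
    (((continuous_apply_apply j j).continuousAt.comp hK).tendsto).eventually
      (lt_mem_nhds hKpos.diag_pos)
  filter_upwards [hreg.isOpen.mem_nhds hreg.mem, eventually_all.2 h] with θ hθ hpos
  refine ⟨hθ, fun j => ?_⟩
  -- If the second moment were infinite, the integral would take the junk value `0`, and the
  -- diagonal entry of `K` would be `-ξ_j ^ 2 ≤ 0`.
  by_contra hn
  have h1 := hpos j
  simp only [K, KMat, of_apply] at h1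
  simp_rw [mul_assoc (_ * _)] at h1
  rw [integral_undef hn] at h1
  nlinarith [mul_self_nonneg (xiVec μ f β (f θ) θ j)]

include hf hβ hreg in
/-- Under the density `f_θ`, the estimating function at `θ` is centred with covariance `K(θ)`. -/
lemma moments_estFun {θ : Fin p → ℝ} (hθ : θ ∈ goodSet μ f β ω) (j k : Fin p) :
    AEStronglyMeasurable (fun x => estFun μ f β θ x j) μ ∧
    Integrable (fun x => estFun μ f β θ x j * f θ x) μ ∧
    ∫ x, estFun μ f β θ x j * f θ x ∂μ = 0 ∧
    Integrable (fun x => estFun μ f β θ x j * estFun μ f β θ x k * f θ x) μ ∧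
    ∫ x, estFun μ f β θ x j * estFun μ f β θ x k * f θ x ∂μ = K μ f β θ j k := by
  have hΘ := hreg.subset hθ.1
  have hnn := hf.nonneg θ hΘ
  have hsm := hreg.aestronglyMeasurable_score hf hβ hθ.1
  have hfi := hf.integrable hΘ
  have hf1 := hf.integral_eq_one hΘ
  have hs1 : ∀ j, Integrable (fun x => score f θ x j * f θ x ^ β * f θ x) μ := fun j =>
    (hreg.integrable_score_mul hf hβ hθ.1 j).congr (.of_forall fun x => by
      simp only [rpow_one_add hβ (hnn x), mul_assoc])
  have hx1 : ∀ j, ∫ x, score f θ x j * f θ x ^ β * f θ x ∂μ = xi μ f β θ j := fun j =>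
    integral_congr_ae (.of_forall fun x => by simp only [rpow_one_add hβ (hnn x), mul_assoc])
  have hpow : ∀ x, f θ x ^ (2 * β) = f θ x ^ β * f θ x ^ β := fun x => by
    rw [two_mul, Real.rpow_add_of_nonneg (hnn x) hβ hβ]
  have hs2 : Integrable (fun x => score f θ x j * score f θ x k *
      (f θ x ^ (2 * β) * f θ x)) μ :=
    integrable_mul_mul_of_sq (hsm j) (hsm k)
      (fun x => mul_nonneg (Real.rpow_nonneg (hnn x) _) (hnn x))
      (((hf.measurable _ hΘ).pow_const _).mul (hf.measurable _ hΘ)).aestronglyMeasurable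
      (hθ.2 j) (hθ.2 k)
  have e1 : (fun x => estFun μ f β θ x j * f θ x) = fun x =>
      score f θ x j * f θ x ^ β * f θ x - xi μ f β θ j * f θ x := by
    ext x; simp only [estFun]; ring
  have e2 : (fun x => estFun μ f β θ x j * estFun μ f β θ x k * f θ x) = fun x =>
      score f θ x j * score f θ x k * (f θ x ^ (2 * β) * f θ x) -
        xi μ f β θ k * (score f θ x j * f θ x ^ β * f θ x) -
        (xi μ f β θ j * (score f θ x k * f θ x ^ β * f θ x) -
          xi μ f β θ j * xi μ f β θ k * f θ x) := by
    ext x; simp only [estFun, hpow]; ring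
  have i1 : Integrable (fun x => score f θ x j * score f θ x k * (f θ x ^ (2 * β) * f θ x) -
        xi μ f β θ k * (score f θ x j * f θ x ^ β * f θ x)) μ :=
    hs2.sub ((hs1 j).const_mul _)
  have i2 : Integrable (fun x => xi μ f β θ j * (score f θ x k * f θ x ^ β * f θ x) -
          xi μ f β θ j * xi μ f β θ k * f θ x) μ :=
    ((hs1 k).const_mul _).sub (hfi.const_mul _)
  refine ⟨((hsm j).mul ((hf.measurable _ hΘ).pow_const _).aestronglyMeasurable).sub
    aestronglyMeasurable_const, ?_, ?_, ?_, ?_⟩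
  · rw [e1]
    exact (hs1 j).sub (hfi.const_mul _)
  · rw [e1, integral_sub (hs1 j) (hfi.const_mul _), hx1, integral_const_mul, hf1]
    ring
  · rw [e2]
    exact i1.sub i2
  · rw [e2, integral_sub i1 i2, integral_sub hs2 ((hs1 j).const_mul _),
      integral_sub ((hs1 k).const_mul _) (hfi.const_mul _)]
    simp only [integral_const_mul, hx1, hf1]
    have hxv : ∀ j, xiVec μ f β (f θ) θ j = xi μ f β θ j := hx1
    simp only [K, KMat, of_apply, hxv, mul_assoc (_ * _)]
    ring

include hf hβ hreg in
/-- The estimating function and the density are continuous at `θ₀` for almost every `x`. -/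
lemma tendsto_estFun {θ : ℕ → Fin p → ℝ} (hθω : ∀ n, θ n ∈ ω)
    (hθ : Tendsto θ atTop (𝓝 θ₀)) :
    ∀ᵐ x ∂μ, (∀ j, Tendsto (fun n => estFun μ f β (θ n) x j) atTop
      (𝓝 (estFun μ f β θ₀ x j))) ∧ Tendsto (fun n => f (θ n) x) atTop (𝓝 (f θ₀ x)) := by
  filter_upwards [hreg.smooth] with x hs
  refine ⟨fun j => Tendsto.sub ?_
    ((hreg.differentiableAt_xi hf hβ hreg.mem j).continuousAt.tendsto.comp hθ),
    (hreg.differentiableAt hreg.mem hs).continuousAt.tendsto.comp hθ⟩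
  by_cases hx : 0 < f θ₀ x
  · exact (hreg.differentiableAt_score_mul hreg.mem hs hx j).continuousAt.tendsto.comp hθ
  · simp only [hreg.score_eq_zero hf (hθω _) hx, hreg.score_eq_zero hf hreg.mem hx, zero_mul]
    exact tendsto_const_nhds

include hf hβ hreg in
/-- A uniform linear approximation of the estimating function near `θ₀`, with an integrable
constant. -/
lemma exists_estFun_expansion (j : Fin p) : ∃ b : X → ℝ, Integrable (fun x => b x * f θ₀ x) μ ∧
    ∀ᵐ x ∂μ, 0 < f θ₀ x → ∀ ρ, Metric.closedBall θ₀ ρ ⊆ ω →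
      ∀ θ ∈ Metric.closedBall θ₀ ρ, ∀ θ' ∈ Metric.closedBall θ₀ ρ,
        |(1 + β) * (estFun μ f β θ' x j - estFun μ f β θ x j) -
          ∑ k, pd k (pd j fun θ' => V μ f β θ' x) θ₀ * (θ k - θ' k)| ≤ b x * ρ * ‖θ - θ'‖ := by
  choose B hBi hB using fun k l => hreg.third j k l
  refine ⟨fun x => ∑ k, ∑ l, B k l x, ?_, ?_⟩
  · simp_rw [Finset.sum_mul]
    exact integrable_finsetSum _ fun k _ => integrable_finsetSum _ fun l _ => hBi k l
  · have hB' := ae_all_iff.2 fun k => ae_all_iff.2 fun l => hB k l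
    filter_upwards [hreg.smooth, hB'] with x hs hBx hx ρ hρ θ hθ θ' hθ'
    have := abs_sub_sub_sum_pd_le (G := pd j fun θ' => V μ f β θ' x) (B := fun k l => B k l x)
      (fun τ hτ => hreg.differentiableAt_pd_V hf hβ (hρ hτ) hs hx j)
      (fun k τ hτ => hreg.differentiableAt_pd_pd_V hf hβ (hρ hτ) hs hx j k)
      (fun k l τ hτ => hBx k l hx τ (hρ hτ)) hθ hθ'
    rw [hreg.pd_V hf hβ (hρ hθ) hs hx, hreg.pd_V hf hβ (hρ hθ') hs hx] at this
    convert this using 2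
    ring

end Regularity
end Model

/-! ### Gaussian quadratic forms and the noncentral chi-square law -/

section Gaussian

variable {p r : ℕ}

/-- By rotation invariance of the standard Gaussian law, the law of `‖v + Z‖ ^ 2` depends on the
shift `v` only through its norm. -/
lemma map_stdGaussian_norm_sq_congr {v a : EuclideanSpace ℝ (Fin r)} (h : ‖v‖ = ‖a‖) :
    (stdGaussian (EuclideanSpace ℝ (Fin r))).map (fun z => ‖v + z‖ ^ 2) =
      (stdGaussian (EuclideanSpace ℝ (Fin r))).map (fun z => ‖a + z‖ ^ 2) := by
  set R : EuclideanSpace ℝ (Fin r) ≃ₗᵢ[ℝ] EuclideanSpace ℝ (Fin r) :=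
    (Submodule.span ℝ {v - a})ᗮ.reflection with hR
  have hRv : R v = a := Submodule.reflection_sub h
  have hmap : (stdGaussian (EuclideanSpace ℝ (Fin r))).map R = stdGaussian _ :=
    stdGaussian_map R
  conv_rhs => rw [← hmap]
  rw [Measure.map_map (by fun_prop) R.continuous.measurable]
  congr 1
  ext z
  rw [Function.comp_apply, ← hRv, ← map_add, R.norm_map]

lemma noncentralChiSq_eq_map_stdGaussian {c : ℝ} (hc : 0 ≤ c)
    {v : EuclideanSpace ℝ (Fin r)} (hv : ‖v‖ ^ 2 = c) :
    noncentralChiSq r c = (stdGaussian (EuclideanSpace ℝ (Fin r))).map (fun z => ‖v + z‖ ^ 2) := by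
  set a : EuclideanSpace ℝ (Fin r) := WithLp.toLp 2 fun _ => √(c / r) with ha
  have hva : ‖v‖ = ‖a‖ := by
    rcases Nat.eq_zero_or_pos r with rfl | hr
    · rw [Subsingleton.elim v a]
    · have hr' : (0 : ℝ) < r := by exact_mod_cast hr
      rw [← sq_eq_sq₀ (norm_nonneg _) (norm_nonneg _), hv, EuclideanSpace.real_norm_sq_eq]
      simp only [ha, Finset.sum_const, Finset.card_univ, Fintype.card_fin, nsmul_eq_mul]
      rw [Real.sq_sqrt (by positivity)]
      field_simp
  rw [map_stdGaussian_norm_sq_congr hva, ← map_pi_eq_stdGaussian,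
    Measure.map_map (by fun_prop) (by fun_prop), noncentralChiSq]
  congr 1
  ext z
  rw [Function.comp_apply, EuclideanSpace.real_norm_sq_eq]
  refine Finset.sum_congr rfl fun i _ => ?_
  simp [ha, add_comm]

open scoped MatrixOrder in
/-- The Wald quadratic form of a Gaussian vector with the matching covariance has a noncentral
chi-square law. -/
lemma map_multivariateGaussian_wald {S : Matrix (Fin p) (Fin p) ℝ} (hS : S.PosSemidef)
    {C : Matrix (Fin r) (Fin p) ℝ} (hC : (C * S * Cᵀ).PosDef) (η : Fin r → ℝ) :
    (multivariateGaussian 0 S).map (fun s : EuclideanSpace ℝ (Fin p) =>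
      (η + C *ᵥ s) ⬝ᵥ (C * S * Cᵀ)⁻¹ *ᵥ (η + C *ᵥ s)) =
      noncentralChiSq r (η ⬝ᵥ (C * S * Cᵀ)⁻¹ *ᵥ η) := by
  obtain ⟨A, hA⟩ := CStarAlgebra.nonneg_iff_eq_star_mul_self.mp hC.inv.posSemidef.nonneg
  have hA' : (C * S * Cᵀ)⁻¹ = Aᵀ * A := by
    rw [hA, star_eq_conjTranspose, conjTranspose_eq_transpose_of_trivial]
  -- `A * C` maps `N(0, S)` to the standard Gaussian law.
  have hone : A * C * S * (A * C)ᵀ = 1 := by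
    have h1 : Aᵀ * (A * (C * S * Cᵀ)) = 1 := by
      rw [← Matrix.mul_assoc, ← hA', nonsing_inv_mul _ ((isUnit_iff_isUnit_det _).1 hC.isUnit)]
    rw [mul_eq_one_comm] at h1
    rw [transpose_mul, ← h1]
    simp only [Matrix.mul_assoc]
  have hq : ∀ w : Fin r → ℝ, w ⬝ᵥ (C * S * Cᵀ)⁻¹ *ᵥ w =
      ‖(WithLp.toLp 2 (A *ᵥ w) : EuclideanSpace ℝ (Fin r))‖ ^ 2 := by
    intro w
    rw [hA', EuclideanSpace.real_norm_sq_eq, ← mulVec_mulVec, dotProduct_mulVec,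
      vecMul_transpose]
    simp [dotProduct, sq]
  have hlin : Continuous fun s : EuclideanSpace ℝ (Fin p) =>
      (WithLp.toLp 2 ((A * C) *ᵥ s) : EuclideanSpace ℝ (Fin r)) := by
    refine (PiLp.continuous_toLp 2 _).comp ?_
    exact Continuous.matrix_mulVec continuous_const (PiLp.continuous_ofLp 2 _)
  have hstd : (multivariateGaussian 0 S).map (fun s : EuclideanSpace ℝ (Fin p) =>
      (WithLp.toLp 2 ((A * C) *ᵥ s) : EuclideanSpace ℝ (Fin r))) =
      stdGaussian (EuclideanSpace ℝ (Fin r)) := by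
    have : IsProbabilityMeasure ((multivariateGaussian 0 S).map
        (fun s : EuclideanSpace ℝ (Fin p) =>
          (WithLp.toLp 2 ((A * C) *ᵥ s) : EuclideanSpace ℝ (Fin r)))) :=
      Measure.isProbabilityMeasure_map hlin.measurable.aemeasurable
    refine Measure.ext_of_charFun ?_
    ext t
    have h1 : charFun ((multivariateGaussian 0 S).map (fun s : EuclideanSpace ℝ (Fin p) =>
        (WithLp.toLp 2 ((A * C) *ᵥ s) : EuclideanSpace ℝ (Fin r)))) t =
        charFun (multivariateGaussian 0 S) (WithLp.toLp 2 ((A * C)ᵀ *ᵥ t)) := by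
      rw [charFun_apply, charFun_apply, integral_map hlin.measurable.aemeasurable (by fun_prop)]
      refine integral_congr_ae (.of_forall fun s => ?_)
      simp only
      congr 3
      rw [EuclideanSpace.inner_eq_star_dotProduct, EuclideanSpace.inner_eq_star_dotProduct]
      simp only [star_trivial]
      rw [dotProduct_mulVec, ← mulVec_transpose]
    rw [h1, charFun_multivariateGaussian hS, charFun_stdGaussian]
    congr 1
    have h2 : ((A * C)ᵀ *ᵥ t) ⬝ᵥ S *ᵥ ((A * C)ᵀ *ᵥ t) = ‖t‖ ^ 2 := by
      rw [mulVec_transpose, ← dotProduct_mulVec, mulVec_mulVec, ← mulVec_transpose,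
        mulVec_mulVec, hone, one_mulVec, EuclideanSpace.real_norm_sq_eq]
      simp [dotProduct, sq]
    rw [inner_zero_right]
    simp only [h2]
    push_cast
    ring
  rw [noncentralChiSq_eq_map_stdGaussian (by rw [hq]; positivity) (hq η).symm, ← hstd, Measure.map_map (by fun_prop) hlin.measurable]
  congr 1
  ext s
  rw [Function.comp_apply, hq, mulVec_add, mulVec_mulVec, ← WithLp.toLp_add]

end Gaussian

/-! ### Asymptotics of the estimator under contiguous alternatives -/

section Estimator

variable {p r : ℕ} {X : Type*} [MeasurableSpace X] {μ : Measure X} {Θ : Set (Fin p → ℝ)}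
  {f : (Fin p → ℝ) → X → ℝ} {β : ℝ} {θ₀ : Fin p → ℝ} {ω : Set (Fin p → ℝ)}

lemma IsDensityFamily.isProbabilityMeasure (hf : IsDensityFamily μ Θ f) {θ : Fin p → ℝ}
    (hθ : θ ∈ Θ) : IsProbabilityMeasure (μ.withDensity fun x => ENNReal.ofReal (f θ x)) :=
  ⟨by rw [withDensity_apply _ .univ, setLIntegral_univ, hf.lintegral_eq_one θ hθ]⟩

/-- The weak law of large numbers for samples from the model. -/
lemma IsDensityFamily.tendsto_average (hf : IsDensityFamily μ Θ f) {θ : Fin p → ℝ}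
    (hθ : θ ∈ Θ) {g : X → ℝ} (hg : Integrable (fun x => g x * f θ x) μ) :
    Tendsto (fun s : Σ n, Fin n → X => (s.1 : ℝ)⁻¹ * ∑ i, g (s.2 i))
      (whp fun n => sampleLaw μ f θ n) (𝓝 (∫ x, g x * f θ x ∂μ)) := by
  have := hf.isProbabilityMeasure hθ
  have hm := (hf.measurable θ hθ).ennreal_ofReal
  have hlt : ∀ᵐ x ∂μ, ENNReal.ofReal (f θ x) < ⊤ := .of_forall fun _ => ENNReal.ofReal_lt_top
  have hint : ∫ x, g x * f θ x ∂μ =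
      ∫ x, g x ∂μ.withDensity fun x => ENNReal.ofReal (f θ x) := by
    rw [integral_withDensity_eq_integral_toReal_smul hm hlt]
    refine integral_congr_ae (.of_forall fun x => ?_)
    simp only [ENNReal.toReal_ofReal (hf.nonneg θ hθ x), smul_eq_mul, mul_comm]
  rw [hint]
  refine tendsto_average_whp ((integrable_withDensity_iff hm hlt).2 ?_)
  simpa only [ENNReal.toReal_ofReal (hf.nonneg θ hθ _)] using hg

/-- A property of almost every point of the support holds at all sample points. -/
lemma IsDensityFamily.eventually_forall (hf : IsDensityFamily μ Θ f) {θ : Fin p → ℝ}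
    (hθ : θ ∈ Θ) {q : X → Prop} (hq : ∀ᵐ x ∂μ, 0 < f θ x → q x) :
    ∀ᶠ s : Σ n, Fin n → X in whp fun n => sampleLaw μ f θ n, ∀ i, q (s.2 i) := by
  have := hf.isProbabilityMeasure hθ
  have h : ∀ᵐ x ∂μ.withDensity fun x => ENNReal.ofReal (f θ x), q x := by
    rw [ae_withDensity_iff (hf.measurable θ hθ).ennreal_ofReal]
    filter_upwards [hq] with x hx h0
    exact hx (by simpa using h0)
  exact eventually_whp_of_ae fun n => ae_all_iff.2 fun i =>
    (Measure.quasiMeasurePreserving_eval (fun _ : Fin n => _) i).ae h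

/-- The normalized sum `n^{1/2} Ψ_n(θ_n)` of the estimating function at the true parameter. -/
def normScore (μ : Measure X) (f : (Fin p → ℝ) → X → ℝ) (β : ℝ) (θ : ℕ → Fin p → ℝ)
    (s : Σ n, Fin n → X) : EuclideanSpace ℝ (Fin p) :=
  WithLp.toLp 2 fun j => (√(s.1 : ℝ))⁻¹ * ∑ i, estFun μ f β (θ s.1) (s.2 i) j

lemma aemeasurable_normScore (hf : IsDensityFamily μ Θ f) (hβ : 0 ≤ β)
    (hreg : Regularity μ Θ f β (f θ₀) θ₀ ω) {θ : ℕ → Fin p → ℝ}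
    (hθg : ∀ n, θ n ∈ Regularity.goodSet μ f β ω) (n : ℕ) :
    AEMeasurable (fun x => normScore μ f β θ ⟨n, x⟩) (sampleLaw μ f (θ n) n) := by
  have := hf.isProbabilityMeasure (hreg.subset (hθg n).1)
  have h1 : ∀ (i : Fin n) (j : Fin p), AEMeasurable
      (fun x : Fin n → X => estFun μ f β (θ n) (x i) j) (sampleLaw μ f (θ n) n) := fun i j =>
    (((hreg.moments_estFun hf hβ (hθg n) j j).1.mono_ac
      (withDensity_absolutelyContinuous _ _)).aemeasurable).comp_quasiMeasurePreserving
      (Measure.quasiMeasurePreserving_eval _ i)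
  have h2 : ∀ j : Fin p, AEMeasurable (fun x : Fin n → X =>
      (√(n : ℝ))⁻¹ * ∑ i, estFun μ f β (θ n) (x i) j) (sampleLaw μ f (θ n) n) := fun j =>
    (Finset.aemeasurable_fun_sum _ fun i _ => h1 i j).const_mul _
  exact (WithLp.measurable_toLp 2 _).comp_aemeasurable (aemeasurable_pi_lambda _ h2)

/-- The central limit theorem for the estimating function along `θ_n → θ₀`: since `K` is
continuous at `θ₀`, neither a rate for `θ_n` nor Lindeberg's condition is needed. -/
lemma tendsto_charFun_normScore (hf : IsDensityFamily μ Θ f) (hβ : 0 ≤ β)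
    (hreg : Regularity μ Θ f β (f θ₀) θ₀ ω) (hK : ContinuousAt (K μ f β) θ₀)
    (hKpos : (K μ f β θ₀).PosDef) {θ : ℕ → Fin p → ℝ}
    (hθg : ∀ n, θ n ∈ Regularity.goodSet μ f β ω) (hθ : Tendsto θ atTop (𝓝 θ₀))
    (t : EuclideanSpace ℝ (Fin p)) :
    Tendsto (fun n => charFun ((sampleLaw μ f (θ n) n).map
      fun x => normScore μ f β θ ⟨n, x⟩) t) atTop
      (𝓝 (charFun (multivariateGaussian 0 (K μ f β θ₀)) t)) := by
  have hΘ : ∀ n, θ n ∈ Θ := fun n => hreg.subset (hθg n).1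
  have hmom := fun n j k => hreg.moments_estFun hf hβ (hθg n) j k
  have hmom0 := fun j k => hreg.moments_estFun hf hβ
    (mem_of_mem_nhds (hreg.goodSet_mem_nhds hK hKpos)) j k
  have h := tendsto_charFun_sum (μ := μ) (q := fun n => f (θ n)) (q₀ := f θ₀)
    (Z := fun n => estFun μ f β (θ n)) (Z₀ := estFun μ f β θ₀) (S := K μ f β θ₀)
    (fun n => hf.measurable _ (hΘ n)) (fun n => hf.nonneg _ (hΘ n))
    (fun n => hf.lintegral_eq_one _ (hΘ n)) (fun n j => (hmom n j j).1)
    (fun n j => (hmom n j j).2.1) (fun n j => (hmom n j j).2.2.1)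
    (fun n j k => (hmom n j k).2.2.2.1) (fun j k => (hmom0 j k).2.2.2.1)
    (fun j k => (hmom0 j k).2.2.2.2) (hreg.tendsto_estFun hf hβ (fun n => (hθg n).1) hθ)
    (fun j k => by
      simp_rw [fun n => (hmom n j k).2.2.2.2]
      exact ((continuous_apply_apply j k).continuousAt.comp hK).tendsto.comp hθ) t
  rw [charFun_multivariateGaussian hKpos.posSemidef]
  have he : ((inner ℝ t 0 : ℝ) : ℂ) * Complex.I -
      ((t ⬝ᵥ K μ f β θ₀ *ᵥ t : ℝ) : ℂ) / 2 = -((t ⬝ᵥ K μ f β θ₀ *ᵥ t : ℝ) : ℂ) / 2 := by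
    rw [inner_zero_right]
    push_cast
    ring
  rw [he]
  exact h

lemma boundedInProb_normScore (hf : IsDensityFamily μ Θ f) (hβ : 0 ≤ β)
    (hreg : Regularity μ Θ f β (f θ₀) θ₀ ω) (hK : ContinuousAt (K μ f β) θ₀)
    (hKpos : (K μ f β θ₀).PosDef) {θ : ℕ → Fin p → ℝ}
    (hθg : ∀ n, θ n ∈ Regularity.goodSet μ f β ω) (hθ : Tendsto θ atTop (𝓝 θ₀)) :
    BoundedInProb (fun n => sampleLaw μ f (θ n) n) (normScore μ f β θ) := by
  have hP : ∀ n, IsProbabilityMeasure (sampleLaw μ f (θ n) n) := fun n => by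
    have := hf.isProbabilityMeasure (hreg.subset (hθg n).1)
    unfold sampleLaw; infer_instance
  have hYm := aemeasurable_normScore hf hβ hreg hθg
  have := fun n => Measure.isProbabilityMeasure_map (hYm n)
  have htight := isTightMeasureSet_of_tendsto_charFun
    (continuous_charFun (μ := multivariateGaussian 0 (K μ f β θ₀))).continuousAt
    (tendsto_charFun_normScore hf hβ hreg hK hKpos hθg hθ)
  intro ε hε
  obtain ⟨C, hC, hCε⟩ := isTightMeasureSet_iff_exists_isCompact_measure_compl_le.1 htight ε hε
  refine ⟨C, hC, fun n => ?_⟩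
  refine le_trans ?_ (hCε _ ⟨n, rfl⟩)
  exact (Measure.le_map_apply (hYm n) Cᶜ)

lemma exists_norm_mulVec_le {a b : ℕ} (A : Matrix (Fin a) (Fin b) ℝ) :
    ∃ C, 0 ≤ C ∧ ∀ v : Fin b → ℝ, ‖A *ᵥ v‖ ≤ C * ‖v‖ :=
  ⟨‖(mulVecLin A).toContinuousLinearMap‖, norm_nonneg _, fun v =>
    (mulVecLin A).toContinuousLinearMap.le_opNorm v⟩

/-- Averaging the expansion of the estimating function over a sample for which `T` solves the
estimating equation. -/
lemma abs_normScore_sub_le {θ T : Fin p → ℝ} {n : ℕ} (hn : 0 < n) {x : Fin n → X}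
    (hroot : IsRoot μ f β x T) {j : Fin p} {h : Fin p → X → ℝ} {b : X → ℝ} {ρ : ℝ}
    (hb : ∀ i, |(1 + β) * (estFun μ f β θ (x i) j - estFun μ f β T (x i) j) -
      ∑ k, h k (x i) * (T k - θ k)| ≤ b (x i) * ρ * ‖T - θ‖) :
    |(1 + β) * ((√(n : ℝ))⁻¹ * ∑ i, estFun μ f β θ (x i) j) -
      ∑ k, ((n : ℝ)⁻¹ * ∑ i, h k (x i)) * (√(n : ℝ) • (T - θ)) k| ≤
      ((n : ℝ)⁻¹ * ∑ i, b (x i)) * ρ * ‖√(n : ℝ) • (T - θ)‖ := by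
  have hn' : (0 : ℝ) < n := by exact_mod_cast hn
  have hs : 0 < √(n : ℝ) := Real.sqrt_pos.2 hn'
  have hs2 : √(n : ℝ) * √(n : ℝ) = n := Real.mul_self_sqrt hn'.le
  have hc : (n : ℝ)⁻¹ * √(n : ℝ) = (√(n : ℝ))⁻¹ := by
    rw [inv_mul_eq_iff_eq_mul₀ hn'.ne', ← div_eq_mul_inv, eq_div_iff hs.ne', hs2]
  have hr : ∑ i, estFun μ f β T (x i) j = 0 := by
    have := hroot j
    simp only [estFun, Finset.sum_sub_distrib, Finset.sum_const, Finset.card_univ,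
      Fintype.card_fin, nsmul_eq_mul]
    have h2 : ∑ i, score f T (x i) j * f T (x i) ^ β = n * xi μ f β T j := by
      rw [sub_eq_zero] at this
      rw [xi, ← this]
      field_simp
    rw [h2, sub_self]
  have hsum : ∑ i, ((1 + β) * (estFun μ f β θ (x i) j - estFun μ f β T (x i) j) -
      ∑ k, h k (x i) * (T k - θ k)) =
      (1 + β) * ∑ i, estFun μ f β θ (x i) j - ∑ k, (∑ i, h k (x i)) * (T k - θ k) := by
    rw [Finset.sum_sub_distrib, ← Finset.mul_sum, Finset.sum_sub_distrib, hr, sub_zero,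
      Finset.sum_comm]
    simp_rw [Finset.sum_mul]
  have hle : |∑ i, ((1 + β) * (estFun μ f β θ (x i) j - estFun μ f β T (x i) j) -
      ∑ k, h k (x i) * (T k - θ k))| ≤ (∑ i, b (x i)) * ρ * ‖T - θ‖ := by
    refine (Finset.abs_sum_le_sum_abs _ _).trans ?_
    rw [mul_assoc, Finset.sum_mul]
    refine Finset.sum_le_sum fun i _ => ?_
    rw [← mul_assoc]
    exact hb i
  rw [hsum] at hle
  have e1 : (1 + β) * ((√(n : ℝ))⁻¹ * ∑ i, estFun μ f β θ (x i) j) -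
      ∑ k, ((n : ℝ)⁻¹ * ∑ i, h k (x i)) * (√(n : ℝ) • (T - θ)) k = (√(n : ℝ))⁻¹ *
      ((1 + β) * ∑ i, estFun μ f β θ (x i) j - ∑ k, (∑ i, h k (x i)) * (T k - θ k)) := by
    rw [mul_sub, Finset.mul_sum (f := fun k => (∑ i, h k (x i)) * (T k - θ k))]
    congr 1
    · ring
    · refine Finset.sum_congr rfl fun k _ => ?_
      simp only [Pi.smul_apply, Pi.sub_apply, smul_eq_mul]
      linear_combination ((∑ i, h k (x i)) * (T k - θ k)) * hc
  rw [e1, abs_mul, abs_of_pos (inv_pos.2 hs), norm_smul, Real.norm_of_nonneg hs.le]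
  refine (mul_le_mul_of_nonneg_left hle (inv_pos.2 hs).le).trans (le_of_eq ?_)
  linear_combination -((∑ i, b (x i)) * ρ * ‖T - θ‖) * hc

/-- The linearized estimating equation: `n^{1/2} Ψ_n(θ_n) = (J(θ₀) + o_P(1)) n^{1/2} (T_n - θ_n)`
under the contiguous alternatives. -/
lemma exists_linearization (hf : IsDensityFamily μ Θ f) (hβ : 0 ≤ β)
    (hreg : Regularity μ Θ f β (f θ₀) θ₀ ω) {T : ∀ n : ℕ, (Fin n → X) → Fin p → ℝ}
    (hT : IsConsistentRootSeq μ f β θ₀ T) {θ : ℕ → Fin p → ℝ} (hθ : Tendsto θ atTop (𝓝 θ₀))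
    (hcont : Contiguous (fun n : ℕ => sampleLaw μ f (θ n) n) (fun n => sampleLaw μ f θ₀ n)) :
    Tendsto (fun s : Σ n, Fin n → X => T s.1 s.2) (whp fun n => sampleLaw μ f (θ n) n) (𝓝 θ₀) ∧
    ∃ τ : (Σ n, Fin n → X) → ℝ, Tendsto τ (whp fun n => sampleLaw μ f (θ n) n) (𝓝 0) ∧
      ∀ᶠ s in whp fun n => sampleLaw μ f (θ n) n,
        ‖(normScore μ f β θ s).ofLp - J μ f β θ₀ *ᵥ (√(s.1 : ℝ) • (T s.1 s.2 - θ s.1))‖ ≤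
          τ s * ‖√(s.1 : ℝ) • (T s.1 s.2 - θ s.1)‖ := by
  have hle := hcont.whp_le
  have hΘ := hreg.subset hreg.mem
  set l := whp fun n => sampleLaw μ f (θ n) n with hl
  have hT0 : Tendsto (fun s : Σ n, Fin n → X => T s.1 s.2) l (𝓝 θ₀) := by
    refine Tendsto.mono_left (Metric.tendsto_nhds.2 fun ε hε => eventually_whp.2 ?_) hle
    simpa only [not_lt] using hT.consistent ε hε
  have hθl : Tendsto (fun s : Σ n, Fin n → X => θ s.1) l (𝓝 θ₀) :=
    hθ.comp (tendsto_fst_whp _)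
  refine ⟨hT0, ?_⟩
  have hroot : ∀ᶠ s : Σ n, Fin n → X in l, IsRoot μ f β s.2 (T s.1 s.2) :=
    hle (eventually_whp.2 hT.root)
  choose b hbi hb using fun j => hreg.exists_estFun_expansion hf hβ j
  have hgood := hle (hf.eventually_forall hΘ (q := fun x => ∀ j, ∀ ρ,
    Metric.closedBall θ₀ ρ ⊆ ω → ∀ θ ∈ Metric.closedBall θ₀ ρ, ∀ θ' ∈ Metric.closedBall θ₀ ρ,
      |(1 + β) * (estFun μ f β θ' x j - estFun μ f β θ x j) -
        ∑ k, pd k (pd j fun θ' => V μ f β θ' x) θ₀ * (θ k - θ' k)| ≤ b j x * ρ * ‖θ - θ'‖) (by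
    filter_upwards [ae_all_iff.2 hb] with x hx h0 j
    exact hx j h0))
  have hH : ∀ j k, Tendsto (fun s : Σ n, Fin n → X => (s.1 : ℝ)⁻¹ *
      ∑ i, pd k (pd j fun θ' => V μ f β θ' (s.2 i)) θ₀) l (𝓝 ((1 + β) * J μ f β θ₀ j k)) := by
    intro j k
    rw [← (hreg.integral_pd_pd_V hf hβ j k).2]
    exact (hf.tendsto_average hΘ (hreg.integral_pd_pd_V hf hβ j k).1).mono_left hle
  have hB : ∀ j, Tendsto (fun s : Σ n, Fin n → X => (s.1 : ℝ)⁻¹ * ∑ i, b j (s.2 i)) l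
      (𝓝 (∫ x, b j x * f θ₀ x ∂μ)) := fun j =>
    (hf.tendsto_average hΘ (hbi j)).mono_left hle
  -- The expansion holds on the smallest ball around `θ₀` containing `T_n` and `θ_n`.
  set ρ : (Σ n, Fin n → X) → ℝ := fun s => max (dist (T s.1 s.2) θ₀) (dist (θ s.1) θ₀) with hρ
  have hρ0 : Tendsto ρ l (𝓝 0) := by
    have := (tendsto_iff_dist_tendsto_zero.1 hT0).max (tendsto_iff_dist_tendsto_zero.1 hθl)
    rwa [max_self] at this
  refine ⟨fun s => ∑ j, (|(s.1 : ℝ)⁻¹ * ∑ i, b j (s.2 i)| * ρ s + ∑ k, |(s.1 : ℝ)⁻¹ *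
    ∑ i, pd k (pd j fun θ' => V μ f β θ' (s.2 i)) θ₀ - (1 + β) * J μ f β θ₀ j k|), ?_, ?_⟩
  · have h1 : Tendsto (fun s : Σ n, Fin n → X => ∑ j, (|(s.1 : ℝ)⁻¹ * ∑ i, b j (s.2 i)| * ρ s +
        ∑ k, |(s.1 : ℝ)⁻¹ * ∑ i, pd k (pd j fun θ' => V μ f β θ' (s.2 i)) θ₀ -
        (1 + β) * J μ f β θ₀ j k|)) l
        (𝓝 (∑ j, (|∫ x, b j x * f θ₀ x ∂μ| * 0 +
          ∑ k, |(1 + β) * J μ f β θ₀ j k - (1 + β) * J μ f β θ₀ j k|))) :=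
      tendsto_finsetSum _ fun j _ => ((hB j).abs.mul hρ0).add
        (tendsto_finsetSum _ fun k _ => ((hH j k).sub_const _).abs)
    simpa using h1
  · obtain ⟨ε, hε, hεω⟩ := Metric.isOpen_iff.1 hreg.isOpen θ₀ hreg.mem
    filter_upwards [hroot, hgood, hρ0.eventually (gt_mem_nhds hε),
      (tendsto_fst_whp _).eventually (eventually_gt_atTop 0)] with s hr hg hρs hn
    obtain ⟨n, x⟩ := s
    simp only at hr hg hρs hn ⊢
    set δ := √(n : ℝ) • (T n x - θ n) with hδ
    have hball : Metric.closedBall θ₀ (ρ ⟨n, x⟩) ⊆ ω :=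
      (Metric.closedBall_subset_ball hρs).trans hεω
    have hρnn : 0 ≤ ρ ⟨n, x⟩ := dist_nonneg.trans (le_max_left _ _)
    have hnn : ∀ j, 0 ≤ |(n : ℝ)⁻¹ * ∑ i, b j (x i)| * ρ ⟨n, x⟩ + ∑ k, |(n : ℝ)⁻¹ *
        ∑ i, pd k (pd j fun θ' => V μ f β θ' (x i)) θ₀ - (1 + β) * J μ f β θ₀ j k| := fun j =>
      add_nonneg (mul_nonneg (abs_nonneg _) hρnn) (Finset.sum_nonneg fun k _ => abs_nonneg _)
    refine (pi_norm_le_iff_of_nonneg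
      (mul_nonneg (Finset.sum_nonneg fun j _ => hnn j) (norm_nonneg _))).2 fun j => ?_
    have h1 := abs_normScore_sub_le (μ := μ) (f := f) hn hr (j := j)
      (h := fun k x => pd k (pd j fun θ' => V μ f β θ' x) θ₀) (b := b j) (ρ := ρ ⟨n, x⟩)
      (θ := θ n) fun i => hg i j _ hball _
      (Metric.mem_closedBall.2 (le_max_left _ _)) _ (Metric.mem_closedBall.2 (le_max_right _ _))
    rw [← hδ] at h1
    set Hb : Fin p → ℝ := fun k =>
      (n : ℝ)⁻¹ * ∑ i, pd k (pd j fun θ' => V μ f β θ' (x i)) θ₀ with hHb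
    have h2 : |∑ k, (Hb k - (1 + β) * J μ f β θ₀ j k) * δ k| ≤
        (∑ k, |Hb k - (1 + β) * J μ f β θ₀ j k|) * ‖δ‖ := by
      rw [Finset.sum_mul]
      refine (Finset.abs_sum_le_sum_abs _ _).trans (Finset.sum_le_sum fun k _ => ?_)
      rw [abs_mul]
      exact mul_le_mul_of_nonneg_left (norm_le_pi_norm δ k) (abs_nonneg _)
    set Sj : ℝ := (√(n : ℝ))⁻¹ * ∑ i, estFun μ f β (θ n) (x i) j with hSj
    have h3 : (1 + β) * (Sj - ∑ k, J μ f β θ₀ j k * δ k) =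
        ((1 + β) * Sj - ∑ k, Hb k * δ k) +
          ∑ k, (Hb k - (1 + β) * J μ f β θ₀ j k) * δ k := by
      simp only [sub_mul, Finset.sum_sub_distrib, mul_sub, Finset.mul_sum, mul_assoc]
      ring
    have h4 : |Sj - ∑ k, J μ f β θ₀ j k * δ k| ≤
        (|(n : ℝ)⁻¹ * ∑ i, b j (x i)| * ρ ⟨n, x⟩ +
          ∑ k, |Hb k - (1 + β) * J μ f β θ₀ j k|) * ‖δ‖ := by
      calc |Sj - ∑ k, J μ f β θ₀ j k * δ k|
          ≤ (1 + β) * |Sj - ∑ k, J μ f β θ₀ j k * δ k| :=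
            le_mul_of_one_le_left (abs_nonneg _) (by linarith)
        _ = |(1 + β) * (Sj - ∑ k, J μ f β θ₀ j k * δ k)| := by
            rw [abs_mul, abs_of_nonneg (by linarith : 0 ≤ 1 + β)]
        _ ≤ _ := by
            rw [h3, add_mul (|(n : ℝ)⁻¹ * ∑ i, b j (x i)| * ρ ⟨n, x⟩)]
            refine (abs_add_le _ _).trans (add_le_add (h1.trans ?_) h2)
            gcongr
            exact le_abs_self _
    refine le_trans ?_ (h4.trans (mul_le_mul_of_nonneg_right
      (Finset.single_le_sum (f := fun j => |(n : ℝ)⁻¹ * ∑ i, b j (x i)| * ρ ⟨n, x⟩ +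
        ∑ k, |(n : ℝ)⁻¹ * ∑ i, pd k (pd j fun θ' => V μ f β θ' (x i)) θ₀ -
          (1 + β) * J μ f β θ₀ j k|) (fun j _ => hnn j) (Finset.mem_univ j)) (norm_nonneg _)))
    exact le_of_eq rfl

end Estimator

/-! ### The Wald-type statistic -/

section Wald

variable {p r : ℕ} {X : Type*} [MeasurableSpace X] {μ : Measure X} {Θ : Set (Fin p → ℝ)}
  {f : (Fin p → ℝ) → X → ℝ} {β : ℝ} {θ₀ : Fin p → ℝ} {ω : Set (Fin p → ℝ)}
  {m : (Fin p → ℝ) → Fin r → ℝ}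

lemma mulVec_injective_of_rank_eq {M : Matrix (Fin p) (Fin r) ℝ} (h : M.rank = r) :
    Function.Injective M.mulVec := by
  have h1 := LinearMap.finrank_range_add_finrank_ker M.mulVecLin
  rw [← Matrix.rank, h, Module.finrank_fin_fun] at h1
  have h2 : LinearMap.ker M.mulVecLin = ⊥ := Submodule.finrank_eq_zero.1 (by omega)
  exact LinearMap.ker_eq_bot.1 h2

/-- `fderiv` of the restriction function is multiplication by the transpose of `M`. -/
lemma fderiv_apply_eq_MMat (hm : DifferentiableAt ℝ m θ₀) (v : Fin p → ℝ) :
    fderiv ℝ m θ₀ v = (MMat m θ₀)ᵀ *ᵥ v := by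
  ext k
  have h1 : fderiv ℝ (fun θ => m θ k) θ₀ v = fderiv ℝ m θ₀ v k := by
    rw [((hasFDerivAt_pi'.1 hm.hasFDerivAt) k).fderiv]
    rfl
  rw [← h1, fderiv_apply_eq_sum_pd]
  rfl

lemma continuousAt_MMat (hm : ContDiffAt ℝ 1 m θ₀) : ContinuousAt (MMat m) θ₀ := by
  refine continuousAt_pi.2 fun i => continuousAt_pi.2 fun k => ?_
  have h : ContDiffAt ℝ 1 (fun θ => m θ k) θ₀ := contDiffAt_pi.1 hm k
  exact ((h.fderiv_right (m := 0) (by norm_num)).continuousAt).clm_apply continuousAt_const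

lemma continuousAt_inv {k : ℕ} {A : (Fin p → ℝ) → Matrix (Fin k) (Fin k) ℝ}
    (hA : ContinuousAt A θ₀) (h : (A θ₀).PosDef) : ContinuousAt (fun θ => (A θ)⁻¹) θ₀ := by
  have h1 : ContinuousAt Inv.inv (A θ₀) := by
    refine continuousAt_matrix_inv _ ?_
    rw [Ring.inverse_eq_inv']
    exact continuousAt_inv₀ h.det_pos.ne'
  exact ContinuousAt.comp h1 hA

lemma continuousAt_mul {a b c : ℕ} {A : (Fin p → ℝ) → Matrix (Fin a) (Fin b) ℝ}
    {B : (Fin p → ℝ) → Matrix (Fin b) (Fin c) ℝ} (hA : ContinuousAt A θ₀)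
    (hB : ContinuousAt B θ₀) : ContinuousAt (fun θ => A θ * B θ) θ₀ :=
  ContinuousAt.comp (f := fun θ => (A θ, B θ)) (g := fun q => q.1 * q.2)
    (continuous_fst.matrix_mul continuous_snd).continuousAt (hA.prodMk hB)

lemma continuousAt_sigmaMat (hm : ContDiffAt ℝ 1 m θ₀) (hJ : ContinuousAt (J μ f β) θ₀)
    (hJpos : (J μ f β θ₀).PosDef) (hK : ContinuousAt (K μ f β) θ₀) :
    ContinuousAt (sigmaMat μ f β m) θ₀ := by
  have hM := continuousAt_MMat hm
  have hJi := continuousAt_inv hJ hJpos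
  have hMt : ContinuousAt (fun θ => (MMat m θ)ᵀ) θ₀ :=
    (continuous_id.matrix_transpose.continuousAt).comp hM
  exact continuousAt_mul (continuousAt_mul (continuousAt_mul (continuousAt_mul hMt hJi) hK) hJi) hM

lemma transpose_inv_of_posDef {A : Matrix (Fin p) (Fin p) ℝ} (hA : A.PosDef) : A⁻¹ᵀ = A⁻¹ := by
  have := hA.inv.isHermitian.eq
  rwa [conjTranspose_eq_transpose_of_trivial] at this

lemma sigmaMat_eq (hJpos : (J μ f β θ₀).PosDef) :
    sigmaMat μ f β m θ₀ = (MMat m θ₀)ᵀ * (J μ f β θ₀)⁻¹ * K μ f β θ₀ *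
      ((MMat m θ₀)ᵀ * (J μ f β θ₀)⁻¹)ᵀ := by
  rw [transpose_mul, transpose_transpose, transpose_inv_of_posDef hJpos, sigmaMat]
  simp only [Matrix.mul_assoc]

lemma posDef_sigmaMat (hJpos : (J μ f β θ₀).PosDef) (hKpos : (K μ f β θ₀).PosDef)
    (hrank : (MMat m θ₀).rank = r) : (sigmaMat μ f β m θ₀).PosDef := by
  have hinj : Function.Injective ((J μ f β θ₀)⁻¹ * MMat m θ₀).mulVec := by
    have h1 : Function.Injective (J μ f β θ₀)⁻¹.mulVec :=
      mulVec_injective_iff_isUnit.2 hJpos.inv.isUnit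
    have : ((J μ f β θ₀)⁻¹ * MMat m θ₀).mulVec = (J μ f β θ₀)⁻¹.mulVec ∘ (MMat m θ₀).mulVec := by
      ext1 v
      exact (mulVec_mulVec _ _ _).symm
    rw [this]
    exact h1.comp (mulVec_injective_of_rank_eq hrank)
  have := hKpos.conjTranspose_mul_mul_same hinj
  rw [conjTranspose_eq_transpose_of_trivial, transpose_mul, transpose_inv_of_posDef hJpos] at this
  rw [sigmaMat]
  simpa only [Matrix.mul_assoc] using this

/-- The delta method: `n^{1/2} m(T_n) - η - Mᵀ J⁻¹ (n^{1/2} Ψ_n(θ_n)) → 0` in probability, when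
`n^{1/2} m(θ_n) → η`. -/
lemma tendsto_deltaMethod {P : ∀ n : ℕ, Measure (Fin n → X)} {S : (Σ n, Fin n → X) →
      EuclideanSpace ℝ (Fin p)} (hS : BoundedInProb P S)
    {T : ∀ n : ℕ, (Fin n → X) → Fin p → ℝ} {θ : ℕ → Fin p → ℝ} (hθ : Tendsto θ atTop (𝓝 θ₀))
    (hT : Tendsto (fun s : Σ n, Fin n → X => T s.1 s.2) (whp P) (𝓝 θ₀))
    {A : Matrix (Fin p) (Fin p) ℝ} (hA : A.PosDef) {τ : (Σ n, Fin n → X) → ℝ}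
    (hτ : Tendsto τ (whp P) (𝓝 0))
    (hlin : ∀ᶠ s in whp P, ‖(S s).ofLp - A *ᵥ (√(s.1 : ℝ) • (T s.1 s.2 - θ s.1))‖ ≤
      τ s * ‖√(s.1 : ℝ) • (T s.1 s.2 - θ s.1)‖)
    (hm : ContDiffAt ℝ 1 m θ₀) {η : Fin r → ℝ}
    (hη : Tendsto (fun n : ℕ => √(n : ℝ) • m (θ n)) atTop (𝓝 η)) :
    Tendsto (fun s : Σ n, Fin n → X => √(s.1 : ℝ) • m (T s.1 s.2) -
      (η + ((MMat m θ₀)ᵀ * A⁻¹) *ᵥ (S s).ofLp)) (whp P) (𝓝 0) := by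
  obtain ⟨C, hC0, hC⟩ := exists_norm_mulVec_le A⁻¹
  obtain ⟨D, hD0, hD⟩ := exists_norm_mulVec_le (MMat m θ₀)ᵀ
  have hdiff := hm.differentiableAt one_ne_zero
  set R : (Σ n, Fin n → X) → Fin r → ℝ := fun s => m (T s.1 s.2) - m (θ s.1) -
    fderiv ℝ m θ₀ (T s.1 s.2 - θ s.1) with hR
  set κ : (Σ n, Fin n → X) → ℝ := fun s => ‖R s‖ / ‖T s.1 s.2 - θ s.1‖ with hκ
  have hκ0 : Tendsto κ (whp P) (𝓝 0) := by
    have h1 := (hm.hasStrictFDerivAt one_ne_zero).isLittleO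
    have h2 : Tendsto (fun s : Σ n, Fin n → X => (T s.1 s.2, θ s.1)) (whp P) (𝓝 (θ₀, θ₀)) :=
      hT.prodMk_nhds (hθ.comp (tendsto_fst_whp P))
    exact (h1.comp_tendsto h2).norm_norm.tendsto_div_nhds_zero
  have hη' : Tendsto (fun s : Σ n, Fin n → X => √(s.1 : ℝ) • m (θ s.1) - η) (whp P) (𝓝 0) := by
    simpa using (hη.comp (tendsto_fst_whp P)).sub_const η
  have hbound : Tendsto (fun s => ‖√(s.1 : ℝ) • m (θ s.1) - η‖ +
      ‖(S s).ofLp‖ * (D * C * (2 * C) * |τ s| + 2 * C * κ s)) (whp P) (𝓝 0) := by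
    have h1 : Tendsto (fun s => D * C * (2 * C) * |τ s| + 2 * C * κ s) (whp P) (𝓝 0) := by
      have := (hτ.abs.const_mul (D * C * (2 * C))).add (hκ0.const_mul (2 * C))
      simpa using this
    have h2 := hS.slutsky (g := fun s t => ‖s.ofLp‖ * t)
      (((PiLp.continuous_ofLp 2 _).comp continuous_fst).norm.mul continuous_snd) h1
    have h3 := hη'.norm.add h2
    simpa using h3
  have hsmall : ∀ᶠ s in whp P, C * |τ s| < 1 / 2 := by
    have := hτ.abs.const_mul C
    rw [abs_zero, mul_zero] at this
    exact this.eventually (gt_mem_nhds (by norm_num))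
  refine squeeze_zero_norm' ?_ hbound
  filter_upwards [hlin, hsmall] with s hs hsm
  set δ := √(s.1 : ℝ) • (T s.1 s.2 - θ s.1) with hδ
  have hAinv : A⁻¹ * A = 1 := nonsing_inv_mul _ ((isUnit_iff_isUnit_det _).1 hA.isUnit)
  have hdel : δ - A⁻¹ *ᵥ (S s).ofLp = -(A⁻¹ *ᵥ ((S s).ofLp - A *ᵥ δ)) := by
    rw [mulVec_sub, mulVec_mulVec, hAinv, one_mulVec, neg_sub]
  have h1 : ‖δ - A⁻¹ *ᵥ (S s).ofLp‖ ≤ C * |τ s| * ‖δ‖ := by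
    rw [hdel, norm_neg, mul_assoc]
    refine (hC _).trans (mul_le_mul_of_nonneg_left (hs.trans ?_) hC0)
    exact mul_le_mul_of_nonneg_right (le_abs_self _) (norm_nonneg _)
  have h2 : ‖δ‖ ≤ 2 * C * ‖(S s).ofLp‖ := by
    have h3 : ‖δ‖ ≤ ‖δ - A⁻¹ *ᵥ (S s).ofLp‖ + ‖A⁻¹ *ᵥ (S s).ofLp‖ := by
      simpa using norm_add_le (δ - A⁻¹ *ᵥ (S s).ofLp) (A⁻¹ *ᵥ (S s).ofLp)
    have h4 := hC (S s).ofLp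
    have h5 : C * |τ s| * ‖δ‖ ≤ 1 / 2 * ‖δ‖ :=
      mul_le_mul_of_nonneg_right hsm.le (norm_nonneg _)
    linarith
  have hRδ : ‖√(s.1 : ℝ) • R s‖ = κ s * ‖δ‖ := by
    by_cases h0 : T s.1 s.2 - θ s.1 = 0
    · have : R s = 0 := by
        simp only [hR, h0, map_zero, sub_zero]
        rw [sub_eq_zero.1 h0, sub_self]
      simp [this, hδ, h0]
    · have : ‖T s.1 s.2 - θ s.1‖ ≠ 0 := norm_ne_zero_iff.2 h0
      simp only [hκ, hδ, norm_smul]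
      field_simp
  have hsplit : √(s.1 : ℝ) • m (T s.1 s.2) - (η + ((MMat m θ₀)ᵀ * A⁻¹) *ᵥ (S s).ofLp) =
      (√(s.1 : ℝ) • m (θ s.1) - η) + (MMat m θ₀)ᵀ *ᵥ (δ - A⁻¹ *ᵥ (S s).ofLp) +
        √(s.1 : ℝ) • R s := by
    have hMδ : (MMat m θ₀)ᵀ *ᵥ δ = √(s.1 : ℝ) • fderiv ℝ m θ₀ (T s.1 s.2 - θ s.1) := by
      rw [fderiv_apply_eq_MMat hdiff, hδ, mulVec_smul]
    rw [mulVec_sub, mulVec_mulVec, hMδ]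
    simp only [hR, smul_sub]
    abel
  rw [hsplit]
  refine (norm_add₃_le).trans ?_
  rw [add_assoc, hRδ]
  refine add_le_add le_rfl ?_
  have h6 := hD (δ - A⁻¹ *ᵥ (S s).ofLp)
  have hκnn : 0 ≤ κ s := div_nonneg (norm_nonneg _) (norm_nonneg _)
  have h7 : ‖δ - A⁻¹ *ᵥ (S s).ofLp‖ ≤ C * |τ s| * (2 * C * ‖(S s).ofLp‖) :=
    h1.trans (mul_le_mul_of_nonneg_left h2 (by positivity))
  calc _ ≤ D * (C * |τ s| * (2 * C * ‖(S s).ofLp‖)) + κ s * (2 * C * ‖(S s).ofLp‖) :=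
        add_le_add (h6.trans (mul_le_mul_of_nonneg_left h7 hD0))
          (mul_le_mul_of_nonneg_left h2 hκnn)
    _ = _ := by ring

/-- Convergence in law of the Wald-type statistic under contiguous alternatives `θ_n → θ₀` with
`n^{1/2} m(θ_n) → η`. -/
theorem convergesInLaw_wald (hf : IsDensityFamily μ Θ f) (hβ : 0 ≤ β)
    (hm : ContDiffAt ℝ 1 m θ₀) (hreg : Regularity μ Θ f β (f θ₀) θ₀ ω)
    (hJ : ContinuousAt (J μ f β) θ₀) (hK : ContinuousAt (K μ f β) θ₀)
    (hKpos : (K μ f β θ₀).PosDef) (hrank : (MMat m θ₀).rank = r)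
    {T : ∀ n : ℕ, (Fin n → X) → Fin p → ℝ} (hT : IsConsistentRootSeq μ f β θ₀ T)
    {θ : ℕ → Fin p → ℝ} (hθg : ∀ n, θ n ∈ Regularity.goodSet μ f β ω)
    (hθ : Tendsto θ atTop (𝓝 θ₀)) {η : Fin r → ℝ}
    (hη : Tendsto (fun n : ℕ => √(n : ℝ) • m (θ n)) atTop (𝓝 η))
    (hcont : Contiguous (fun n : ℕ => sampleLaw μ f (θ n) n) (fun n => sampleLaw μ f θ₀ n)) :
    ConvergesInLaw (fun n : ℕ => sampleLaw μ f (θ n) n) (fun n x => wald μ f β m n (T n x))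
      (noncentralChiSq r (η ⬝ᵥ (sigmaMat μ f β m θ₀)⁻¹ *ᵥ η)) := by
  have hJpos : (J μ f β θ₀).PosDef := hreg.posDef
  have hSpos := posDef_sigmaMat (m := m) hJpos hKpos hrank
  have hP : ∀ n, IsProbabilityMeasure (sampleLaw μ f (θ n) n) := fun n => by
    have := hf.isProbabilityMeasure (hreg.subset (hθg n).1)
    unfold sampleLaw; infer_instance
  set P : ∀ n : ℕ, Measure (Fin n → X) := fun n => sampleLaw μ f (θ n) n with hPdef
  set S := normScore μ f β θ with hSdef
  have hSm : ∀ n, AEMeasurable (fun x => S ⟨n, x⟩) (P n) :=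
    aemeasurable_normScore hf hβ hreg hθg
  have hSb : BoundedInProb P S := boundedInProb_normScore hf hβ hreg hK hKpos hθg hθ
  obtain ⟨hT0, τ, hτ, hlin⟩ := exists_linearization hf hβ hreg hT hθ hcont
  set C := (MMat m θ₀)ᵀ * (J μ f β θ₀)⁻¹ with hC
  have he := tendsto_deltaMethod hSb hθ hT0 hJpos hτ hlin hm hη
  have hQ : Tendsto (fun s : Σ n, Fin n → X => (sigmaMat μ f β m (T s.1 s.2))⁻¹) (whp P)
      (𝓝 (sigmaMat μ f β m θ₀)⁻¹) :=
    (continuousAt_inv (continuousAt_sigmaMat hm hJ hJpos hK) hSpos).tendsto.comp hT0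
  set g : EuclideanSpace ℝ (Fin p) → (Fin r → ℝ) × Matrix (Fin r) (Fin r) ℝ → ℝ := fun s z =>
    (η + C *ᵥ s.ofLp + z.1) ⬝ᵥ z.2 *ᵥ (η + C *ᵥ s.ofLp + z.1) with hg
  have hgc : Continuous (Function.uncurry g) := by
    have h1 : Continuous fun q : EuclideanSpace ℝ (Fin p) × (Fin r → ℝ) ×
        Matrix (Fin r) (Fin r) ℝ => η + C *ᵥ q.1.ofLp + q.2.1 :=
      (continuous_const.add (continuous_const.matrix_mulVec
        ((PiLp.continuous_ofLp 2 _).comp continuous_fst))).add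
        (continuous_fst.comp continuous_snd)
    exact h1.dotProduct ((continuous_snd.comp continuous_snd).matrix_mulVec h1)
  have hslut := hSb.slutsky hgc (he.prodMk_nhds hQ)
  have hweak : Tendsto (β := ProbabilityMeasure (EuclideanSpace ℝ (Fin p)))
      (fun n => ⟨(P n).map (fun x => S ⟨n, x⟩), Measure.isProbabilityMeasure_map (hSm n)⟩) atTop
      (𝓝 ⟨multivariateGaussian 0 (K μ f β θ₀), inferInstance⟩) :=
    ProbabilityMeasure.tendsto_of_tendsto_charFun
      (tendsto_charFun_normScore hf hβ hreg hK hKpos hθg hθ)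
  have hlaw := convergesInLaw_of_tendsto_sub hSm hweak
    (g := fun s => g s (0, (sigmaMat μ f β m θ₀)⁻¹))
    (hgc.comp (continuous_id.prodMk continuous_const))
    (W := fun n x => wald μ f β m n (T n x)) (hslut.congr fun s => ?_)
  · have hSig := sigmaMat_eq (m := m) hJpos
    rw [← hC] at hSig
    have := map_multivariateGaussian_wald hKpos.posSemidef (C := C) (hSig ▸ hSpos) η
    rw [← hSig] at this
    rw [← this]
    have hg0 : (fun s => g s (0, (sigmaMat μ f β m θ₀)⁻¹)) = fun s =>
        (η + C *ᵥ s.ofLp) ⬝ᵥ (sigmaMat μ f β m θ₀)⁻¹ *ᵥ (η + C *ᵥ s.ofLp) := by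
      ext s
      simp only [hg, add_zero]
    rw [hg0] at hlaw
    exact hlaw
  · have hsq : √(s.1 : ℝ) * √(s.1 : ℝ) = s.1 := Real.mul_self_sqrt (Nat.cast_nonneg _)
    simp only [hg]
    rw [add_sub_cancel]
    congr 1
    rw [wald, mulVec_smul, dotProduct_smul, smul_dotProduct, smul_smul, hsq, smul_eq_mul]

lemma convergesInLaw_congr {Ω : ℕ → Type*} [∀ n, MeasurableSpace (Ω n)]
    {P P' : ∀ n, Measure (Ω n)} {Y : ∀ n, Ω n → ℝ} {ν : Measure ℝ}
    (h : ∀ᶠ n in atTop, P n = P' n) (hP : ConvergesInLaw P Y ν) : ConvergesInLaw P' Y ν := by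
  intro t ht
  refine (hP t ht).congr' ?_
  filter_upwards [h] with n hn
  rw [hn]

lemma contiguous_congr {Ω : ℕ → Type*} [∀ n, MeasurableSpace (Ω n)]
    {Q Q' P : ∀ n, Measure (Ω n)} (h : ∀ᶠ n in atTop, Q n = Q' n) (hQ : Contiguous Q P) :
    Contiguous Q' P := by
  intro A hA hPA
  refine (hQ A hA hPA).congr' ?_
  filter_upwards [h] with n hn
  rw [hn]

/-- `convergesInLaw_wald` without the assumption that all `θ n` lie in `Regularity.goodSet`: only
finitely many of them do not, and a limit in law ignores these. -/
theorem convergesInLaw_wald_of_tendsto (hf : IsDensityFamily μ Θ f) (hβ : 0 ≤ β)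
    (hm : ContDiffAt ℝ 1 m θ₀) (hreg : Regularity μ Θ f β (f θ₀) θ₀ ω)
    (hJ : ContinuousAt (J μ f β) θ₀) (hK : ContinuousAt (K μ f β) θ₀)
    (hKpos : (K μ f β θ₀).PosDef) (hrank : (MMat m θ₀).rank = r)
    {T : ∀ n : ℕ, (Fin n → X) → Fin p → ℝ} (hT : IsConsistentRootSeq μ f β θ₀ T)
    {θ : ℕ → Fin p → ℝ} (hθ : Tendsto θ atTop (𝓝 θ₀)) {η : Fin r → ℝ}
    (hη : Tendsto (fun n : ℕ => √(n : ℝ) • m (θ n)) atTop (𝓝 η))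
    (hcont : Contiguous (fun n : ℕ => sampleLaw μ f (θ n) n) (fun n => sampleLaw μ f θ₀ n)) :
    ConvergesInLaw (fun n : ℕ => sampleLaw μ f (θ n) n) (fun n x => wald μ f β m n (T n x))
      (noncentralChiSq r (η ⬝ᵥ (sigmaMat μ f β m θ₀)⁻¹ *ᵥ η)) := by
  classical
  have hU := hreg.goodSet_mem_nhds hK hKpos
  set θ' : ℕ → Fin p → ℝ := fun n =>
    if θ n ∈ Regularity.goodSet μ f β ω then θ n else θ₀ with hθ'
  have heq : ∀ᶠ n in atTop, θ n = θ' n := by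
    filter_upwards [hθ.eventually hU] with n hn
    exact (if_pos hn).symm
  have hlaw : ∀ᶠ n in atTop, sampleLaw μ f (θ n) n = sampleLaw μ f (θ' n) n := by
    filter_upwards [heq] with n hn
    rw [hn]
  refine convergesInLaw_congr (hlaw.mono fun n hn => hn.symm)
    (convergesInLaw_wald hf hβ hm hreg hJ hK hKpos hrank hT (θ := θ') (fun n => ?_)
      (hθ.congr' heq) (hη.congr' (heq.mono fun n hn => by rw [hn])) (contiguous_congr hlaw hcont))
  simp only [hθ']
  split_ifs with h
  · exact h
  · exact mem_of_mem_nhds hU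

end Wald

end DPD
end

open DPD
theorem mainTheorem2 {p r : ℕ} {X : Type*} [MeasurableSpace X] (μ : Measure X) [SigmaFinite μ]
    (Θ : Set (Fin p → ℝ)) (f : (Fin p → ℝ) → X → ℝ) (hf : IsDensityFamily μ Θ f)
    (β : ℝ) (hβ : 0 ≤ β)
    (m : (Fin p → ℝ) → Fin r → ℝ) (hm : ContDiffOn ℝ 1 m (interior Θ))
    (θ₀ : Fin p → ℝ) (ω : Set (Fin p → ℝ))
    (hreg : Regularity μ Θ f β (f θ₀) θ₀ ω)
    (hJ : ContinuousAt (J μ f β) θ₀) (hK : ContinuousAt (K μ f β) θ₀)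
    (hKpos : (K μ f β θ₀).PosDef)
    (hm₀ : m θ₀ = 0) (hrank : (MMat m θ₀).rank = r)
    (T : ∀ n : ℕ, (Fin n → X) → Fin p → ℝ) (hT : IsConsistentRootSeq μ f β θ₀ T) :
    (∀ d : Fin p → ℝ,
      Contiguous (fun n : ℕ => sampleLaw μ f (θ₀ + (√(n : ℝ))⁻¹ • d) n)
        (fun n => sampleLaw μ f θ₀ n) →
      ConvergesInLaw (fun n : ℕ => sampleLaw μ f (θ₀ + (√(n : ℝ))⁻¹ • d) n)
        (fun n x => wald μ f β m n (T n x))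
        (noncentralChiSq r
          (d ⬝ᵥ (MMat m θ₀ * (sigmaMat μ f β m θ₀)⁻¹ * (MMat m θ₀)ᵀ) *ᵥ d))) ∧
    (∀ (δ : Fin r → ℝ) (θ : ℕ → Fin p → ℝ),
      Tendsto θ atTop (𝓝 θ₀) →
      (∀ᶠ n : ℕ in atTop, m (θ n) = (√(n : ℝ))⁻¹ • δ) →
      Contiguous (fun n : ℕ => sampleLaw μ f (θ n) n) (fun n => sampleLaw μ f θ₀ n) →
      ConvergesInLaw (fun n : ℕ => sampleLaw μ f (θ n) n)
        (fun n x => wald μ f β m n (T n x))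
        (noncentralChiSq r (δ ⬝ᵥ (sigmaMat μ f β m θ₀)⁻¹ *ᵥ δ))) := by
  have hmd : ContDiffAt ℝ 1 m θ₀ := hm.contDiffAt
    (isOpen_interior.mem_nhds (interior_maximal hreg.subset hreg.isOpen hreg.mem))
  have hsqrt : Tendsto (fun n : ℕ => √(n : ℝ)) atTop atTop :=
    Real.tendsto_sqrt_atTop.comp tendsto_natCast_atTop_atTop
  refine ⟨fun d hcont => ?_, fun δ θ hθ hmθ hcont => ?_⟩
  · have hθ : Tendsto (fun n : ℕ => θ₀ + (√(n : ℝ))⁻¹ • d) atTop (𝓝 θ₀) := by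
      simpa using ((tendsto_inv_atTop_zero.comp hsqrt).smul_const d).const_add θ₀
    have hη : Tendsto (fun n : ℕ => √(n : ℝ) • m (θ₀ + (√(n : ℝ))⁻¹ • d)) atTop
        (𝓝 ((MMat m θ₀)ᵀ *ᵥ d)) := by
      have h := (hmd.differentiableAt one_ne_zero).hasFDerivAt.lim d
        (c := fun n : ℕ => √(n : ℝ)) (tendsto_norm_atTop_atTop.comp hsqrt)
      simpa only [hm₀, sub_zero, fderiv_apply_eq_MMat (hmd.differentiableAt one_ne_zero)] using h
    have hd : d ⬝ᵥ (MMat m θ₀ * (sigmaMat μ f β m θ₀)⁻¹ * (MMat m θ₀)ᵀ) *ᵥ d =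
        ((MMat m θ₀)ᵀ *ᵥ d) ⬝ᵥ (sigmaMat μ f β m θ₀)⁻¹ *ᵥ ((MMat m θ₀)ᵀ *ᵥ d) := by
      rw [← mulVec_mulVec, ← mulVec_mulVec, dotProduct_mulVec, ← mulVec_transpose]
    rw [hd]
    exact convergesInLaw_wald_of_tendsto hf hβ hmd hreg hJ hK hKpos hrank hT hθ hη hcont
  · refine convergesInLaw_wald_of_tendsto hf hβ hmd hreg hJ hK hKpos hrank hT hθ ?_ hcont
    refine tendsto_const_nhds.congr' ?_
    filter_upwards [hmθ, eventually_gt_atTop 0] with n hn hn0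
    have : √(n : ℝ) ≠ 0 := (Real.sqrt_pos.2 (by exact_mod_cast hn0)).ne'
    rw [hn, smul_smul, mul_inv_cancel₀ this, one_smul]
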